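/- Let $n\ge 1$ and $b\ge 0$ be integers. A plane partition is a finite set $P$ of triples $(i,j,k)$ of positive integers such that $(i,j,k)\in P$, $1\le i'\le i$, $1\le j'\le j$, $1\le k'\le k$ imply $(i',j',k')\in P$. It is symmetric if $(i,j,k)\in P$ implies $(j,i,k)\in P$. A plane partition contained in the box $n\times n\times 2b$ (i.e. $i,j\le n$, $k\le 2b$ for all $(i,j,k)\in P$) is transpose-complementary if for all $1\le i,j\le n$, $1\le k\le 2b$ exactly one of $(i,j,k)$ and $(n+1-j,n+1-i,2b+1-k)$ lies in $P$. Let $n(P)$ be the number of cubes of $P$ in the upper right quarter of the box, that is, the number of $(i,j,k)\in P$ with $k>b$ and $i\le j$. Write $(x)_m=x(x+1)\cdots(x+m-1)$. Let $\alpha\ge 1$ be an integer. Then there are polynomials $p_1,p_2$ (if $\alpha$ is even) or $p_3,p_4$ (if $\alpha$ is odd) with rational coefficients, depending only on $\alpha$, such that for every integer $b\ge 0$ the $(-1)$-enumeration $\sum_P(-1)^{n(P)}$ over all symmetric transpose-complementary plane partitions $P$ in the box $(2\alpha+1)\times(2\alpha+1)\times 2b$ equals \begin{align*} &\prod_{k=1}^{\alpha/2}\left(\tfrac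 b2+k\right)_{\alpha/2+1}\cdot(b+2\alpha+2)\cdot p_1(b) &&\text{for $\alpha$ even and $b$ even},\\ &\prod_{k=1}^{\alpha/2}\left(\tfrac{b-1}2+k\right)_{\alpha/2+1}\cdot(b-1)\cdot p_2(b) &&\text{for $\alpha$ even and $b$ odd},\\ &\prod_{i=1}^{(\alpha+1)/2}\left(\tfrac{\alpha+b-1}2-i+2\right)_{2i-1}\cdot p_3(b) &&\text{for $\alpha$ odd and $b$ even},\\ &\prod_{i=1}^{(\alpha+1)/2}\left(\tfrac{b+\alpha}2-i+1\right)_{2i-1}\cdot p_4(b) &&\text{for $\alpha$ odd and $b$ odd}. \end{align*} Here $p_1$ and $p_2$ have degree $(\alpha/2)^2-1$, and $p_3$ and $p_4$ have degree $(\alpha^2-1)/4$. -/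

import Mathlib

open Polynomial

/-- A finite set `P` of triples `(i, j, k)` is a plane partition if all its entries are positive
and it contains with `(i, j, k)` every `(i', j', k')` with `1 ≤ i' ≤ i`, `1 ≤ j' ≤ j`,
`1 ≤ k' ≤ k`. -/
structure IsPlanePartition (P : Finset (ℕ × ℕ × ℕ)) : Prop where
  pos : ∀ i j k : ℕ, (i, j, k) ∈ P → 1 ≤ i ∧ 1 ≤ j ∧ 1 ≤ k
  down_closed : ∀ i j k i' j' k' : ℕ, (i, j, k) ∈ P →
    1 ≤ i' → i' ≤ i → 1 ≤ j' → j' ≤ j → 1 ≤ k' → k' ≤ k → (i', j', k') ∈ P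

/-- The cubes of the box with sides `a × b × c`. -/
def planePartitionBox (a b c : ℕ) : Finset (ℕ × ℕ × ℕ) :=
  Finset.Icc 1 a ×ˢ Finset.Icc 1 b ×ˢ Finset.Icc 1 c

/-- `P` is symmetric: `(i, j, k) ∈ P` implies `(j, i, k) ∈ P`. -/
def IsSymmetricPP (P : Finset (ℕ × ℕ × ℕ)) : Prop :=
  ∀ i j k : ℕ, (i, j, k) ∈ P → (j, i, k) ∈ P

/-- `P` is transpose-complementary in the box `a × a × c`: of the two cubes `(i, j, k)` and
`(a + 1 - j, a + 1 - i, c + 1 - k)` of the box, `P` contains exactly one. (The subtractions do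
not truncate in the given ranges.) -/
def IsTransposeComplementaryPP (a c : ℕ) (P : Finset (ℕ × ℕ × ℕ)) : Prop :=
  ∀ i j k : ℕ, 1 ≤ i → i ≤ a → 1 ≤ j → j ≤ a → 1 ≤ k → k ≤ c →
    ((i, j, k) ∈ P ↔ (a + 1 - j, a + 1 - i, c + 1 - k) ∉ P)

open Classical in
/-- The finite set of symmetric transpose-complementary plane partitions contained in the box
`a × a × c`. -/
noncomputable def symmetricTCPP (a c : ℕ) : Finset (Finset (ℕ × ℕ × ℕ)) :=
  (planePartitionBox a a c).powerset.filter fun P =>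
    IsPlanePartition P ∧ IsSymmetricPP P ∧ IsTransposeComplementaryPP a c P

/-- The number `n(P)` of cubes of `P` in the upper right quarter of a box `a × a × 2b`, i.e. of
the cubes `(i, j, k) ∈ P` in the upper half `k > b` and on one side of the symmetry plane `i = j`
(the cubes on that plane are included, so that one cube is counted for each symmetry orbit). -/
def upperRightCount (b : ℕ) (P : Finset (ℕ × ℕ × ℕ)) : ℕ :=
  (P.filter fun q => b < q.2.2 ∧ q.1 ≤ q.2.1).card

/-- The `(-1)`-enumeration of the symmetric transpose-complementary plane partitions in the box
`a × a × 2b`. -/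
noncomputable def signedSymmetricTCPP (a b : ℕ) : ℤ :=
  ∑ P ∈ symmetricTCPP a (2 * b), (-1) ^ upperRightCount b P

/-- The shifted factorial `(x)_n = x (x + 1) ⋯ (x + n - 1)`. -/
def shiftedFactorial (x : ℚ) (n : ℕ) : ℚ := ∏ t ∈ Finset.range n, (x + t)

/-! A symmetric transpose-complementary partition is determined by its heights above level `b` over
the triangle `i ≤ j`, `i + j ≤ 2α + 1`. Read along diagonals, and made strict by adding the position
index, these heights form a triangular interlacing array whose top row is an arbitrary increasing
`α`-tuple below `b + α`. Summing the sign over two consecutive rows at a time, each pair raises the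
degree of the columns by one, so the arrays with top row `l` contribute `pointDet l`, the
determinant with entries `parityBinom m (l j)` (`sum_arraysWithTop`). The signed count is therefore
`pointDetSum α (b + α)`.

To sum over `l`, the rows are placed in an exterior algebra as vectors `v z`. With `s` the sum of
the first `n` vectors and `ω` the sum of `v i * v j` over `i < j < n`, the ordered products of
length `α` add up to a divided power: `ω ^ m / m!` if `α = 2m`, and `ω ^ m * s / m!` if `α = 2m + 1`
(`factorial_nsmul_orderedProdSum`). Both `s` and `ω` are polynomial on each parity class of `n` and
extend to negative `n`; since `v (-1) = 0`, the value at `-1 - n` is again built from only `n`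
vectors. At an integer `z₀` with few vectors, `ω z₀` is nilpotent of low order. Expanding around
`z₀` thus gives zeros of high multiplicity (`X_sub_C_pow_dvd_of_eq_pointDetSum`), and these account
for all the shifted factorials.

For even `α` there is one further root: with `α + 1` points the sum vanishes
(`pointDetSum_two_mul_succ`). This gives `b - 1` on the odd class directly, and `b + 2α + 2` on the
even class through the reciprocity `n ↦ -1 - n`.

The degree of the cofactor requires the exact degree `α(α + 1)/2` on both classes. The leading
coefficient does not change when each `parityBinom m` is replaced by the average of its leading
monomial over the two classes. The determinants then become positive multiples of Vandermonde
products, whose sum has the required growth (`exists_hasLeading_pointDetSum`). -/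

/-! ### Parity binomials and their summation rules -/

/-- The binomial coefficient `C((x + m) / 2, m)` as a polynomial function of `x`. -/
def halfBinom (m : ℕ) (x : ℚ) : ℚ :=
  (∏ i ∈ Finset.range m, ((x + m) / 2 - i)) / (m.factorial : ℚ)

/-- `C((z + m) / 2, m)` if `z` and `m` have the same parity, and `0` otherwise. -/
def parityBinom (m : ℕ) (z : ℤ) : ℚ := if Even (z + m) then halfBinom m z else 0

/-- Reversing the factors, `i ↦ m - 1 - i`, turns each one into its negative. The reciprocity in the
number of points comes from this symmetry. -/
lemma halfBinom_reflect (m : ℕ) (x : ℚ) : halfBinom m (-2 - x) = (-1) ^ m * halfBinom m x := by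
  unfold halfBinom
  rw [← mul_div_assoc]
  congr 1
  rw [← Finset.prod_range_reflect, ← Finset.card_range m, ← Finset.prod_const, Finset.card_range,
    ← Finset.prod_mul_distrib]
  refine Finset.prod_congr rfl fun i hi => ?_
  have : i + 1 ≤ m := Finset.mem_range.1 hi
  rw [Nat.sub_sub, Nat.cast_sub (by omega)]
  push_cast
  ring

lemma halfBinom_pascal (m : ℕ) (x : ℚ) :
    halfBinom (m + 1) (x + 1) - halfBinom (m + 1) (x - 1) = halfBinom m x := by
  unfold halfBinom
  have h0 : (m.factorial : ℚ) ≠ 0 := by exact_mod_cast m.factorial_ne_zero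
  have h1 : ((m : ℚ) + 1) ≠ 0 := by positivity
  rw [Finset.prod_range_succ' (fun i : ℕ => (x + 1 + ((m + 1 : ℕ) : ℚ)) / 2 - i),
    Finset.prod_range_succ (fun i : ℕ => (x - 1 + ((m + 1 : ℕ) : ℚ)) / 2 - i),
    Nat.factorial_succ]
  have e1 : ∀ i ∈ Finset.range m, (x + 1 + ((m + 1 : ℕ) : ℚ)) / 2 - ((i + 1 : ℕ) : ℚ)
      = (x + m) / 2 - i := by intro i _; push_cast; ring
  have e2 : ∀ i ∈ Finset.range m, (x - 1 + ((m + 1 : ℕ) : ℚ)) / 2 - (i : ℚ)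
      = (x + m) / 2 - i := by intro i _; push_cast; ring
  rw [Finset.prod_congr rfl e1, Finset.prod_congr rfl e2]
  push_cast
  field_simp
  ring

lemma parityBinom_reflect (m : ℕ) (z : ℤ) :
    parityBinom m (-2 - z) = (-1) ^ m * parityBinom m z := by
  unfold parityBinom
  have : Even (-2 - z + m) ↔ Even (z + m) := by
    constructor <;> rintro ⟨a, ha⟩
    · exact ⟨m - 1 - a, by omega⟩
    · exact ⟨m - 1 - a, by omega⟩
  by_cases h : Even (z + m)
  · rw [if_pos h, if_pos (this.2 h)]
    push_cast
    exact halfBinom_reflect m z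
  · rw [if_neg h, if_neg (fun h' => h (this.1 h')), mul_zero]

lemma parityBinom_pascal (m : ℕ) (z : ℤ) :
    parityBinom (m + 1) (z + 1) - parityBinom (m + 1) (z - 1) = parityBinom m z := by
  unfold parityBinom
  have h1 : Even (z + 1 + (m + 1 : ℕ)) ↔ Even (z + m) := by
    constructor <;> rintro ⟨a, ha⟩
    · exact ⟨a - 1, by push_cast at ha; omega⟩
    · exact ⟨a + 1, by push_cast; omega⟩
  have h2 : Even (z - 1 + (m + 1 : ℕ)) ↔ Even (z + m) := by
    constructor <;> rintro ⟨a, ha⟩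
    · exact ⟨a, by push_cast at ha; omega⟩
    · exact ⟨a, by push_cast; omega⟩
  by_cases h : Even (z + m)
  · rw [if_pos h, if_pos (h1.2 h), if_pos (h2.2 h)]
    push_cast
    exact halfBinom_pascal m z
  · rw [if_neg h, if_neg (fun h' => h (h1.1 h')), if_neg (fun h' => h (h2.1 h')), sub_zero]

/-- The point `-1` is fixed by `z ↦ -2 - z`, which settles odd `m`; for even `m` the parity is
wrong. -/
lemma parityBinom_neg_one (m : ℕ) : parityBinom m (-1) = 0 := by
  rcases Nat.even_or_odd m with h | h
  · rw [parityBinom, if_neg]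
    rw [Int.not_even_iff_odd]
    exact Odd.add_even (by decide) (by exact_mod_cast h)
  · have := parityBinom_reflect m (-1)
    rw [h.neg_one_pow] at this
    norm_num at this
    linarith

lemma parityBinom_succ_zero (m : ℕ) : parityBinom (m + 1) 0 = 0 := by
  unfold parityBinom
  split_ifs with h
  · unfold halfBinom
    have h' : Even (m + 1) := by
      rw [zero_add] at h
      exact_mod_cast h
    obtain ⟨a, ha⟩ := h'
    rw [Finset.prod_eq_zero (i := a) (Finset.mem_range.2 (by omega)), zero_div]
    rw [ha]; push_cast; ring
  · rfl

lemma parityBinom_zero (z : ℤ) : parityBinom 0 z = if Even z then 1 else 0 := by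
  simp [parityBinom, halfBinom]

lemma sum_range_parityBinom (m n : ℕ) :
    ∑ i ∈ Finset.range n, parityBinom m i =
      parityBinom (m + 1) n + parityBinom (m + 1) ((n : ℤ) - 1) := by
  induction n with
  | zero => simp [parityBinom_succ_zero, parityBinom_neg_one]
  | succ n ih =>
    rw [Finset.sum_range_succ, ih, ← parityBinom_pascal m n]
    push_cast
    rw [add_sub_cancel_right]
    ring

/-- An ordinary sum of `parityBinom m` leaves two boundary terms at adjacent arguments. The
alternating sum telescopes one of them away, so the two summations together stay within the family
and raise `m` by one. -/
lemma sum_range_neg_one_pow_mul_sum_parityBinom (m n : ℕ) :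
    ∑ i ∈ Finset.range (n + 1), (-1 : ℚ) ^ i * ∑ l ∈ Finset.range i, parityBinom m l =
      (-1) ^ n * parityBinom (m + 1) n := by
  induction n with
  | zero => simp [parityBinom_succ_zero]
  | succ n ih =>
    rw [Finset.sum_range_succ, ih, sum_range_parityBinom]
    push_cast
    rw [add_sub_cancel_right, pow_succ]
    ring

lemma sum_range_neg_one_pow_eq (n : ℕ) :
    ∑ i ∈ Finset.range (n + 1), (-1 : ℚ) ^ i = (-1) ^ n * parityBinom 0 n := by
  rw [parityBinom_zero]
  induction n with
  | zero => simp
  | succ n ih =>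
    rw [Finset.sum_range_succ, ih]
    push_cast
    rcases Nat.even_or_odd n with h | h
    · have h1 : Even (n : ℤ) := by exact_mod_cast h
      have h2 : ¬ Even ((n : ℤ) + 1) := by simpa [Int.even_add_one] using h
      rw [if_pos h1, if_neg h2, pow_succ, h.neg_one_pow]; norm_num
    · have h1 : ¬ Even (n : ℤ) := by simpa using h
      have h2 : Even ((n : ℤ) + 1) := by
        rw [Int.even_add_one]; exact h1
      rw [if_neg h1, if_pos h2, pow_succ, h.neg_one_pow]; norm_num

/-! ### Determinants summed over interlacing rows -/

/-- The determinant with rows `parityBinom · (l j)`. -/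
def pointDet {k : ℕ} (l : Fin k → ℤ) : ℚ :=
  (Matrix.of fun j m : Fin k => parityBinom m (l j)).det

/-- Increments of a row sequence: the determinant of the consecutive differences of the rows
`G 0, …, G k` is the determinant of the rows `(1, G j)`. -/
lemma det_cons_one_eq_det_sub {k : ℕ} (G : Fin (k + 1) → Fin k → ℚ) :
    (Matrix.of fun j : Fin (k + 1) => (Fin.cons 1 (G j) : Fin (k + 1) → ℚ)).det =
      (Matrix.of fun j : Fin k => G j.succ - G j.castSucc).det := by
  rw [Matrix.det_eq_of_forall_row_eq_smul_add_pred
    (B := Matrix.of (Fin.cons (Fin.cons 1 (G 0) : Fin (k + 1) → ℚ)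
      fun j : Fin k => (Fin.cons 0 (G j.succ - G j.castSucc) : Fin (k + 1) → ℚ))) (fun _ => 1)]
  · rw [Matrix.det_succ_column_zero, Finset.sum_eq_single 0]
    · simp only [Fin.val_zero, pow_zero, one_mul, Matrix.of_apply, Fin.cons_zero]
      congr 1
    · intro b _ hb
      obtain ⟨c, rfl⟩ := Fin.exists_succ_eq.2 hb
      simp
    · simp
  · intro j
    simp
  · intro i j
    simp only [Matrix.of_apply, Fin.cons_succ, one_mul]
    refine Fin.cases ?_ (fun j => ?_) j
    · simp
    · simp

lemma det_sub_pred_eq_det {k : ℕ} (H : Fin (k + 1) → Fin (k + 1) → ℚ) :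
    (Matrix.of (Fin.cons (H 0) fun j : Fin k => H j.succ - H j.castSucc)).det =
      (Matrix.of H).det := by
  symm
  apply Matrix.det_eq_of_forall_row_eq_smul_add_pred (fun _ => 1)
  · intro j; simp
  · intro i j; simp

/-- Positions of the row directly below `l`. -/
def oddRows {k : ℕ} (l : Fin (k + 1) → ℕ) : Finset (Fin (k + 1) → ℕ) :=
  Fintype.piFinset (Fin.cons (Finset.Ico 0 (l 0 + 1))
    fun j : Fin k => Finset.Ico (l j.castSucc + 1) (l j.succ + 1))

/-- Positions of the row directly below `y`. -/
def evenRows {k : ℕ} (y : Fin (k + 1) → ℕ) : Finset (Fin k → ℕ) :=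
  Fintype.piFinset fun j : Fin k => Finset.Ico (y j.castSucc) (y j.succ)

lemma sum_piFinset_det {k : ℕ} (I : Fin k → Finset ℕ) (f : ℕ → Fin k → ℚ) :
    ∑ y ∈ Fintype.piFinset I, (Matrix.of fun j => f (y j)).det =
      (Matrix.of fun j => ∑ i ∈ I j, f i).det := by
  have := (Matrix.detRowAlternating (n := Fin k) (R := ℚ)).toMultilinearMap.map_sum_finset
    (fun _ i => f i) I
  exact this.symm

/-- The entries of `x` range over independent intervals, so multilinearity moves the sums into the
rows. Each row becomes a difference of two partial sums, which is a row operation on the bordered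
matrix. -/
lemma sum_evenRows_pointDet {k : ℕ} (y : Fin (k + 1) → ℕ) (hy : Monotone y) :
    ∑ x ∈ evenRows y, pointDet (fun j => (x j : ℤ)) =
      (Matrix.of fun j : Fin (k + 1) => (Fin.cons 1 (fun m : Fin k =>
        ∑ i ∈ Finset.range (y j), parityBinom m i) : Fin (k + 1) → ℚ)).det := by
  rw [det_cons_one_eq_det_sub]
  refine (sum_piFinset_det _ (fun i (m : Fin k) => parityBinom m i)).trans ?_
  congr 2
  ext j m
  rw [Finset.sum_Ico_eq_sub _ (hy (Fin.castSucc_le_succ j))]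
  simp

/-- The inner sum creates a column of ones, and the alternating outer sum turns it into `parityBinom
0` and raises every other column index by one. The result is the same kind of determinant, one size
larger. -/
lemma sum_oddRows_sum_evenRows {k : ℕ} (l : Fin (k + 1) → ℕ) (hl : StrictMono l) :
    ∑ y ∈ oddRows l, ∑ x ∈ evenRows y,
      (-1 : ℚ) ^ (∑ j, l j + ∑ j, y j) * pointDet (fun j => (x j : ℤ)) =
    pointDet (fun j => (l j : ℤ)) := by
  have hmono : ∀ y ∈ oddRows l, Monotone y := by
    intro y hy
    rw [oddRows, Fintype.mem_piFinset] at hy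
    refine Fin.monotone_iff_le_succ.2 fun i => ?_
    have h1 := hy i.succ
    have h2 : y i.castSucc ≤ l i.castSucc := by
      have := hy i.castSucc
      revert this
      refine Fin.cases ?_ (fun a => ?_) (i.castSucc) <;> simp
    simp at h1
    omega
  obtain ⟨f, hf⟩ : ∃ f : ℕ → Fin (k + 1) → ℚ, f = fun i => (-1 : ℚ) ^ i • (Fin.cons 1
    (fun m : Fin k => ∑ i ∈ Finset.range i, parityBinom m i) : Fin (k + 1) → ℚ) := ⟨_, rfl⟩
  have key : ∀ y ∈ oddRows l, ∑ x ∈ evenRows y,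
      (-1 : ℚ) ^ (∑ j, l j + ∑ j, y j) * pointDet (fun j => (x j : ℤ)) =
      (-1) ^ (∑ j, l j) * (Matrix.of fun j => f (y j)).det := by
    intro y hy
    rw [← Finset.mul_sum, sum_evenRows_pointDet y (hmono y hy), pow_add, mul_assoc,
      ← Finset.prod_pow_eq_pow_sum _ y, ← Matrix.det_mul_column, hf]
    rfl
  rw [Finset.sum_congr rfl key, ← Finset.mul_sum, oddRows, sum_piFinset_det]
  obtain ⟨H, hH⟩ : ∃ H : Fin (k + 1) → Fin (k + 1) → ℚ,
      H = fun j (m : Fin (k + 1)) => (-1 : ℚ) ^ l j * parityBinom m (l j) := ⟨_, rfl⟩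
  -- The intervals `[0, l 0]`, `(l 0, l 1]`, … are consecutive, so sums over them are successive
  -- differences of sums over initial segments.
  have e : (fun j : Fin (k + 1) => ∑ i ∈ (Fin.cons (Finset.Ico 0 (l 0 + 1))
      fun j : Fin k => Finset.Ico (l j.castSucc + 1) (l j.succ + 1) : Fin (k + 1) → Finset ℕ) j,
      f i) = Fin.cons (H 0) fun j : Fin k => H j.succ - H j.castSucc := by
    have base : ∀ n : ℕ, ∑ i ∈ Finset.range (n + 1), f i =
        fun m : Fin (k + 1) => (-1 : ℚ) ^ n * parityBinom m n := by
      intro n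
      ext m
      rw [Finset.sum_apply, hf]
      refine Fin.cases ?_ (fun m => ?_) m
      · simpa using sum_range_neg_one_pow_eq n
      · simpa using sum_range_neg_one_pow_mul_sum_parityBinom m n
    funext j
    refine Fin.cases ?_ (fun j => ?_) j
    · simp only [Fin.cons_zero, Nat.Ico_zero_eq_range]
      rw [base, hH]
    · simp only [Fin.cons_succ]
      rw [Finset.sum_Ico_eq_sub _ (by have := hl (Fin.castSucc_lt_succ (i := j)); omega),
        base, base, hH]
  rw [e, det_sub_pred_eq_det, pointDet, hH]
  have := Matrix.det_mul_column (fun j : Fin (k + 1) => (-1 : ℚ) ^ l j)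
    (Matrix.of fun j m : Fin (k + 1) => parityBinom m (l j))
  refine (congrArg (_ * ·) this).trans ?_
  rw [Finset.prod_pow_eq_pow_sum, ← mul_assoc, ← mul_pow]
  norm_num

/-! ### Sums over increasing tuples -/

section Increasing

/-- Strictly increasing maps from `Fin m` to the naturals below `n`. -/
def increasing (m n : ℕ) : Finset (Fin m → ℕ) :=
  (Fintype.piFinset fun _ => Finset.range n).filter fun l => StrictMono l

lemma mem_increasing {m n : ℕ} {l : Fin m → ℕ} :
    l ∈ increasing m n ↔ (∀ j, l j < n) ∧ StrictMono l := by
  simp [increasing]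

lemma strictMono_snoc_iff {m n : ℕ} {l : Fin m → ℕ} :
    StrictMono (Fin.snoc l n : Fin (m + 1) → ℕ) ↔ StrictMono l ∧ ∀ j, l j < n := by
  constructor
  · intro h
    refine ⟨fun i j hij => ?_, fun j => ?_⟩
    · simpa using h (Fin.castSucc_lt_castSucc_iff.2 hij)
    · simpa using h (Fin.castSucc_lt_last j)
  · rintro ⟨h1, h2⟩ i j hij
    revert hij
    refine Fin.lastCases ?_ (fun j => ?_) j <;> refine Fin.lastCases ?_ (fun i => ?_) i
    · intro h; exact absurd h (lt_irrefl _)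
    · intro _; simpa using h2 i
    · intro h; exact absurd h (not_lt.2 (Fin.le_last _))
    · intro h; simpa using h1 (Fin.castSucc_lt_castSucc_iff.1 h)

/-- The tuples are split by whether the last entry is below `n` or equal to `n`. -/
lemma sum_increasing_succ {M : Type*} [AddCommMonoid M] (m n : ℕ) (f : (Fin (m + 1) → ℕ) → M) :
    ∑ l ∈ increasing (m + 1) (n + 1), f l =
      ∑ l ∈ increasing (m + 1) n, f l + ∑ l ∈ increasing m n, f (Fin.snoc l n) := by
  classical
  have hinj : Function.Injective fun l : Fin m → ℕ => (Fin.snoc l n : Fin (m + 1) → ℕ) := by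
    intro a b hab
    funext j
    simpa using congrFun hab j.castSucc
  have hd : Disjoint (increasing (m + 1) n) ((increasing m n).map ⟨_, hinj⟩) := by
    rw [Finset.disjoint_left]
    intro l hl hl'
    obtain ⟨l', _, rfl⟩ := Finset.mem_map.1 hl'
    have := (mem_increasing.1 hl).1 (Fin.last m)
    simp at this
  have hm : ∑ l ∈ increasing m n, f (Fin.snoc l n) =
      ∑ l ∈ (increasing m n).map ⟨_, hinj⟩, f l := (Finset.sum_map _ ⟨_, hinj⟩ f).symm
  rw [hm, ← Finset.sum_union hd]
  refine Finset.sum_congr ?_ fun _ _ => rfl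
  ext l
  rw [Finset.mem_union, Finset.mem_map]
  simp only [mem_increasing, Function.Embedding.coeFn_mk]
  constructor
  · rintro ⟨h1, h2⟩
    by_cases h : l (Fin.last m) = n
    · right
      have hl : Fin.snoc (fun j : Fin m => l j.castSucc) n = l := by
        rw [← h]; exact Fin.snoc_init_self l
      rw [← hl, strictMono_snoc_iff] at h2
      exact ⟨_, ⟨h2.2, h2.1⟩, hl⟩
    · left
      refine ⟨fun j => ?_, h2⟩
      have := h1 (Fin.last m)
      have := h2.monotone (Fin.le_last j)
      omega
  · rintro (⟨h1, h2⟩ | ⟨a, ⟨h1, h2⟩, rfl⟩)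
    · exact ⟨fun j => (h1 j).trans (Nat.lt_succ_self n), h2⟩
    · refine ⟨fun j => ?_, strictMono_snoc_iff.2 ⟨h2, h1⟩⟩
      refine Fin.lastCases ?_ (fun j => ?_) j
      · simp
      · simpa using (h1 j).trans (Nat.lt_succ_self n)

lemma increasing_succ_zero (m : ℕ) : increasing (m + 1) 0 = ∅ := by
  ext l
  simp only [mem_increasing, Finset.notMem_empty, iff_false]
  rintro ⟨h, _⟩
  exact absurd (h 0) (Nat.not_lt_zero _)

lemma increasing_zero (n : ℕ) : increasing 0 n = {Fin.elim0} := by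
  ext l
  simp only [mem_increasing, Finset.mem_singleton]
  exact ⟨fun _ => Subsingleton.elim _ _, fun _ => ⟨fun j => j.elim0, fun j => j.elim0⟩⟩

end Increasing

/-! ### Ordered products of anticommuting elements -/

section Anticommuting

variable {R : Type*} [Ring R]

/-- The sum of all products `e l₀ ⋯ e lₘ₋₁` with `l₀ < ⋯ < lₘ₋₁ < n`. -/
def orderedProdSum (e : ℕ → R) (m n : ℕ) : R :=
  ∑ l ∈ increasing m n, (List.ofFn fun j => e (l j)).prod

/-- The sum of all products `e i * e j` with `i < j < n`. -/
def pairSum (e : ℕ → R) (n : ℕ) : R :=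
  ∑ j ∈ Finset.range n, (∑ i ∈ Finset.range j, e i) * e j

lemma orderedProdSum_zero (e : ℕ → R) (n : ℕ) : orderedProdSum e 0 n = 1 := by
  simp [orderedProdSum, increasing_zero]

lemma orderedProdSum_succ_zero (e : ℕ → R) (m : ℕ) : orderedProdSum e (m + 1) 0 = 0 := by
  simp [orderedProdSum, increasing_succ_zero]

lemma orderedProdSum_succ_succ (e : ℕ → R) (m n : ℕ) : orderedProdSum e (m + 1) (n + 1) =
    orderedProdSum e (m + 1) n + orderedProdSum e m n * e n := by
  simp only [orderedProdSum]
  rw [sum_increasing_succ, Finset.sum_mul]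
  congr 1
  refine Finset.sum_congr rfl fun l _ => ?_
  rw [List.ofFn_succ', List.prod_concat]
  simp

lemma orderedProdSum_eq_zero (e : ℕ → R) {m n : ℕ} (h : n < m) : orderedProdSum e m n = 0 := by
  induction n generalizing m with
  | zero =>
    obtain ⟨m, rfl⟩ : ∃ k, m = k + 1 := ⟨m - 1, by omega⟩
    exact orderedProdSum_succ_zero e m
  | succ n ih =>
    obtain ⟨m, rfl⟩ : ∃ k, m = k + 1 := ⟨m - 1, by omega⟩
    rw [orderedProdSum_succ_succ, ih (by omega), ih (by omega), zero_mul, add_zero]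

lemma add_pow_succ_of_sq_eq_zero {x y : R} (h : Commute x y) (hy : y * y = 0) (n : ℕ) :
    (x + y) ^ (n + 1) = x ^ (n + 1) + (n + 1) • (x ^ n * y) := by
  induction n with
  | zero => simp
  | succ n ih =>
    rw [pow_succ, ih, add_mul, mul_add, mul_add, smul_mul_assoc, smul_mul_assoc, mul_assoc (x ^ n),
      mul_assoc (x ^ n), hy, mul_zero, smul_zero, ← h.eq, ← mul_assoc, ← pow_succ, ← pow_succ,
      succ_nsmul (x ^ (n + 1) * y) (n + 1)]
    abel

lemma sum_mul_anticomm {e : ℕ → R} {x : R} (h : ∀ i, e i * x = -(x * e i)) (s : Finset ℕ) :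
    (∑ i ∈ s, e i) * x = -(x * ∑ i ∈ s, e i) := by
  rw [Finset.sum_mul, Finset.mul_sum, ← Finset.sum_neg_distrib]
  exact Finset.sum_congr rfl fun i _ => h i

/-- Passing `x` through two anticommuting factors changes the sign twice. -/
lemma pairSum_commute {e : ℕ → R} {x : R} (h : ∀ i, e i * x = -(x * e i)) (n : ℕ) :
    Commute (pairSum e n) x := by
  refine Commute.sum_left _ _ _ fun j _ => ?_
  change _ * _ = _ * _
  rw [mul_assoc, h j, mul_neg, ← mul_assoc, sum_mul_anticomm h, neg_mul, neg_neg, mul_assoc]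

lemma pairSum_commute_sum {e : ℕ → R} (h : ∀ i j, e i * e j = -(e j * e i)) (n : ℕ)
    (s : Finset ℕ) : Commute (pairSum e n) (∑ i ∈ s, e i) :=
  Commute.sum_right _ _ _ fun i _ => pairSum_commute (fun j => h j i) n

lemma sum_mul_sum_self {e : ℕ → R} (h : ∀ i j, e i * e j = -(e j * e i))
    (h2 : ∀ i, e i * e i = 0) (n : ℕ) :
    (∑ i ∈ Finset.range n, e i) * ∑ i ∈ Finset.range n, e i = 0 := by
  induction n with
  | zero => simp
  | succ n ih =>
    rw [Finset.sum_range_succ, add_mul, mul_add, mul_add, ih, h2, sum_mul_anticomm (fun j => h j n)]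
    abel

/-- A new element `e N` changes the pair sum `ω` into `ω + s * e N`, whose second term commutes with
`ω` and squares to zero. The binomial expansion thus has two terms, and they match the recurrence
for ordered products. The even and odd lengths need each other in the induction. -/
lemma factorial_nsmul_orderedProdSum {e : ℕ → R} (h : ∀ i j, e i * e j = -(e j * e i))
    (h2 : ∀ i, e i * e i = 0) (N : ℕ) : ∀ n : ℕ,
    n.factorial • orderedProdSum e (2 * n) N = pairSum e N ^ n ∧
    n.factorial • orderedProdSum e (2 * n + 1) N =
      pairSum e N ^ n * ∑ i ∈ Finset.range N, e i := by
  induction N with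
  | zero =>
    intro n
    rw [orderedProdSum_succ_zero]
    cases n with
    | zero => simp [orderedProdSum_zero]
    | succ n =>
      rw [show 2 * (n + 1) = 2 * n + 1 + 1 by ring, orderedProdSum_succ_zero]
      simp [pairSum]
  | succ N ih =>
    intro n
    set s := ∑ i ∈ Finset.range N, e i with hs
    have hp : pairSum e (N + 1) = pairSum e N + s * e N := by
      rw [pairSum, Finset.sum_range_succ]; rfl
    have hc : Commute (pairSum e N) (s * e N) :=
      (pairSum_commute_sum h N _).mul_right (pairSum_commute (fun j => h j N) N)
    have hse : s * e N = -(e N * s) := sum_mul_anticomm (fun j => h j N) _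
    have hss : s * s = 0 := sum_mul_sum_self h h2 N
    have hsq : s * e N * (s * e N) = 0 := by
      rw [hse, neg_mul_neg, mul_assoc, ← mul_assoc s, hse, neg_mul, mul_neg, ← mul_assoc,
        ← mul_assoc, h2, zero_mul, zero_mul, neg_zero]
    -- This and the next identity make the correction term vanish when multiplied by `s + e N`,
    -- which is the odd case.
    have hses : s * e N * s = 0 := by
      rw [hse, neg_mul, mul_assoc, hss, mul_zero, neg_zero]
    have hsee : s * e N * e N = 0 := by rw [mul_assoc, h2, mul_zero]
    rw [hp, Finset.sum_range_succ, ← hs]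
    cases n with
    | zero =>
      have := (ih 0).2
      simp only [Nat.factorial_zero, one_smul, pow_zero, one_mul, mul_zero, zero_add,
        orderedProdSum_zero] at this ⊢
      rw [orderedProdSum_succ_succ e 0, this, orderedProdSum_zero, one_mul]
      exact ⟨trivial, rfl⟩
    | succ n =>
      rw [add_pow_succ_of_sq_eq_zero hc hsq]
      constructor
      · rw [show 2 * (n + 1) = 2 * n + 1 + 1 by ring, orderedProdSum_succ_succ, smul_add,
          show 2 * n + 1 + 1 = 2 * (n + 1) by ring, (ih (n + 1)).1, Nat.factorial_succ, mul_smul,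
          ← smul_mul_assoc, (ih n).2, mul_assoc]
      · rw [orderedProdSum_succ_succ, smul_add, (ih (n + 1)).2, ← smul_mul_assoc, (ih (n + 1)).1,
          mul_add, add_mul, add_mul, smul_mul_assoc, smul_mul_assoc, mul_assoc _ (s * e N),
          mul_assoc _ (s * e N), hses, hsee]
        simp

/-- An increasing tuple cannot be longer than the number of available indices. -/
lemma pairSum_pow_eq_zero {e : ℕ → R} (h : ∀ i j, e i * e j = -(e j * e i))
    (h2 : ∀ i, e i * e i = 0) {N n : ℕ} (hn : N < 2 * n) : pairSum e N ^ n = 0 := by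
  rw [← (factorial_nsmul_orderedProdSum h h2 N n).1, orderedProdSum_eq_zero e hn, smul_zero]

lemma pairSum_pow_mul_sum_eq_zero {e : ℕ → R} (h : ∀ i j, e i * e j = -(e j * e i))
    (h2 : ∀ i, e i * e i = 0) {N n : ℕ} (hn : N < 2 * n + 1) :
    pairSum e N ^ n * ∑ i ∈ Finset.range N, e i = 0 := by
  rw [← (factorial_nsmul_orderedProdSum h h2 N n).2, orderedProdSum_eq_zero e hn, smul_zero]

end Anticommuting

/-! ### Polynomial functions with values in a module -/

section PolynomialFunctions

/-- Every polynomial is a difference with step `2`, with control of the degree and of the leading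
coefficient. -/
lemma exists_two_step_antidifference (n : ℕ) : ∀ q : ℚ[X], (∀ k, n ≤ k → q.coeff k = 0) →
    ∃ Q : ℚ[X], (∀ k, n < k → Q.coeff k = 0) ∧
      (∀ m, n = m + 1 → Q.coeff n = q.coeff m / (2 * (m + 1))) ∧
      ∀ x : ℚ, Q.eval (x + 2) - Q.eval x = q.eval x := by
  induction n with
  | zero =>
    intro q hq
    have : q = 0 := by ext k; simpa using hq k (Nat.zero_le k)
    exact ⟨0, by simp, by simp, by simp [this]⟩
  | succ n ih =>
    intro q hq
    -- Chosen so that the two-step difference of `a * X ^ (n + 1)`, with top coefficient `2 * (n +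
    -- 1) * a`, cancels the top coefficient of `q`.
    set a : ℚ := q.coeff n / (2 * (n + 1)) with ha
    have hn : (n : ℚ) + 1 ≠ 0 := by positivity
    obtain ⟨Q, h1, -, h3⟩ := ih (q - (C a * (X + C 2) ^ (n + 1) - C a * X ^ (n + 1))) (by
      intro k hk
      rw [coeff_sub, coeff_sub, coeff_C_mul, coeff_C_mul, coeff_X_add_C_pow, coeff_X_pow]
      rcases hk.eq_or_lt with rfl | hk
      · rw [if_neg (by omega), Nat.choose_succ_self_right, ha]
        simp only [Nat.add_sub_cancel_left]
        push_cast
        field_simp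
        ring
      · rw [hq k hk]
        rcases Nat.eq_or_lt_of_le hk with rfl | hk'
        · simp
        · rw [if_neg (by omega), Nat.choose_eq_zero_of_lt (by omega)]
          simp)
    refine ⟨C a * X ^ (n + 1) + Q, ?_, ?_, ?_⟩
    · intro k hk
      rw [coeff_add, coeff_C_mul, coeff_X_pow, if_neg (by omega), h1 k (by omega)]
      simp
    · rintro m hm
      obtain rfl : n = m := by omega
      rw [coeff_add, coeff_C_mul, coeff_X_pow, if_pos rfl, h1 _ (by omega), ha]
      simp
    · intro x
      have := h3 x
      simp only [eval_sub, eval_mul, eval_C, eval_pow, eval_add, eval_X] at this ⊢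
      linear_combination this

variable {A : Type*} [AddCommGroup A] [Module ℚ A]

/-- Functions `ℤ → A` that are finite sums of terms `q(z) • c` with `q` a polynomial. -/
inductive IsPolyFun : (ℤ → A) → Prop
  | smul (q : ℚ[X]) (c : A) : IsPolyFun fun z => q.eval (z : ℚ) • c
  | add (f g : ℤ → A) : IsPolyFun f → IsPolyFun g → IsPolyFun fun z => f z + g z

namespace IsPolyFun

lemma const (c : A) : IsPolyFun fun _ => c := by
  simpa using smul (1 : ℚ[X]) c

lemma poly_smul (q : ℚ[X]) {f : ℤ → A} (hf : IsPolyFun f) :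
    IsPolyFun fun z => q.eval (z : ℚ) • f z := by
  induction hf with
  | smul p c =>
    have := smul (q * p) c
    simpa [mul_smul] using this
  | add f g _ _ h1 h2 =>
    have := add _ _ h1 h2
    simpa using this

lemma neg {f : ℤ → A} (hf : IsPolyFun f) : IsPolyFun fun z => -f z := by
  simpa using poly_smul (-1 : ℚ[X]) hf

lemma sub {f g : ℤ → A} (hf : IsPolyFun f) (hg : IsPolyFun g) :
    IsPolyFun fun z => f z - g z := by
  simpa [sub_eq_add_neg] using add _ _ hf hg.neg

lemma sum {ι : Type*} (s : Finset ι) {f : ι → ℤ → A} (hf : ∀ i ∈ s, IsPolyFun (f i)) :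
    IsPolyFun fun z => ∑ i ∈ s, f i z := by
  classical
  induction s using Finset.induction_on with
  | empty => simpa using const (0 : A)
  | insert a s ha ih =>
    simp only [Finset.sum_insert ha]
    exact add _ _ (hf a (Finset.mem_insert_self a s))
      (ih fun i hi => hf i (Finset.mem_insert_of_mem hi))

lemma map {B : Type*} [AddCommGroup B] [Module ℚ B] (φ : A →ₗ[ℚ] B) {f : ℤ → A}
    (hf : IsPolyFun f) : IsPolyFun fun z => φ (f z) := by
  induction hf with
  | smul p c => simpa using smul p (φ c)
  | add f g _ _ h1 h2 => simpa using add _ _ h1 h2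

lemma comp_add {f : ℤ → A} (hf : IsPolyFun f) (k : ℤ) : IsPolyFun fun z => f (z + k) := by
  induction hf with
  | smul p c =>
    have := smul (p.comp (X + C (k : ℚ))) c
    simpa using this
  | add f g _ _ h1 h2 => exact add _ _ h1 h2

lemma exists_eq_add_smul {f : ℤ → A} (hf : IsPolyFun f) (z₀ : ℤ) :
    ∃ g : ℤ → A, IsPolyFun g ∧ ∀ z, f z = f z₀ + ((z : ℚ) - z₀) • g z := by
  induction hf with
  | smul p c =>
    obtain ⟨q, hq⟩ := Polynomial.X_sub_C_dvd_sub_C_eval (a := (z₀ : ℚ)) (p := p)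
    refine ⟨_, smul q c, fun z => ?_⟩
    have : p.eval (z : ℚ) = p.eval (z₀ : ℚ) + ((z : ℚ) - z₀) * q.eval (z : ℚ) := by
      have := congrArg (eval (z : ℚ)) hq
      simp only [eval_sub, eval_mul, eval_C, eval_X] at this
      linear_combination this
    simp only [this, add_smul, mul_smul]
  | add f g _ _ h1 h2 =>
    obtain ⟨f', hf', h1⟩ := h1
    obtain ⟨g', hg', h2⟩ := h2
    refine ⟨_, add _ _ hf' hg', fun z => ?_⟩
    simp only [smul_add]
    rw [h1 z, h2 z]
    abel

lemma exists_antidifference {f : ℤ → A} (hf : IsPolyFun f) :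
    ∃ g : ℤ → A, IsPolyFun g ∧ ∀ z, g (z + 2) - g z = f z := by
  induction hf with
  | smul p c =>
    obtain ⟨Q, -, -, hQ⟩ := exists_two_step_antidifference (p.natDegree + 1) p
      fun k hk => coeff_eq_zero_of_natDegree_lt hk
    refine ⟨_, smul Q c, fun z => ?_⟩
    change _ = p.eval (z : ℚ) • c
    rw [← hQ]
    push_cast
    rw [sub_smul]
  | add f g _ _ h1 h2 =>
    obtain ⟨f', hf', h1⟩ := h1
    obtain ⟨g', hg', h2⟩ := h2
    refine ⟨_, add _ _ hf' hg', fun z => ?_⟩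
    change _ = f z + g z
    rw [← h1, ← h2]
    abel

lemma exists_polynomial {f : ℤ → ℚ} (hf : IsPolyFun f) :
    ∃ p : ℚ[X], ∀ z : ℤ, f z = p.eval (z : ℚ) := by
  induction hf with
  | smul p c => exact ⟨p * C c, fun z => by simp⟩
  | add f g _ _ h1 h2 =>
    obtain ⟨p, hp⟩ := h1
    obtain ⟨q, hq⟩ := h2
    exact ⟨p + q, fun z => by simp [hp, hq]⟩

variable {B : Type*} [Ring B] [Algebra ℚ B]

lemma mul {f g : ℤ → B} (hf : IsPolyFun f) (hg : IsPolyFun g) :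
    IsPolyFun fun z => f z * g z := by
  induction hf with
  | smul p c =>
    have : IsPolyFun fun z => c * g z := by
      simpa using map (LinearMap.mulLeft ℚ c) hg
    simpa using poly_smul p this
  | add f g _ _ h1 h2 => simpa [add_mul] using add _ _ h1 h2

lemma pow {f : ℤ → B} (hf : IsPolyFun f) (n : ℕ) : IsPolyFun fun z => f z ^ n := by
  induction n with
  | zero => simpa using const (1 : B)
  | succ n ih => simpa [pow_succ] using mul ih hf

/-- If `a ^ k * c = 0` then the powers of a polynomial function with value `a` at `z₀`, times `c`,
vanish at `z₀` to an order growing with the exponent. -/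
lemma exists_pow_mul_eq {a c : B} {η : ℤ → B} (hη : IsPolyFun η) (z₀ : ℤ)
    (hcomm : ∀ z, Even (z - z₀) → z ≠ z₀ → Commute a (η z)) {k : ℕ} (hk : a ^ k * c = 0) (n : ℕ) :
    ∀ j r : ℕ, r + k ≤ n + j + 1 → ∃ Θ : ℤ → B, IsPolyFun Θ ∧
      ∀ z, Even (z - z₀) → z ≠ z₀ →
      a ^ j * (a + ((z : ℚ) - z₀) • η z) ^ n * c = ((z : ℚ) - z₀) ^ r • Θ z := by
  have hlin : IsPolyFun fun z : ℤ => ((z : ℚ) - z₀) • η z := by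
    have e : ∀ z : ℤ, (X - C (z₀ : ℚ) : ℚ[X]).eval (z : ℚ) = z - z₀ :=
      fun z => by rw [eval_sub, eval_X, eval_C]
    have h := poly_smul (X - C (z₀ : ℚ) : ℚ[X]) hη
    rwa [show (fun z : ℤ => (X - C (z₀ : ℚ) : ℚ[X]).eval (z : ℚ) • η z) =
      fun z : ℤ => ((z : ℚ) - z₀) • η z from funext fun z => by rw [e]] at h
  have hf : IsPolyFun fun z : ℤ => a + ((z : ℚ) - z₀) • η z := add _ _ (const a) hlin
  induction n with
  | zero =>
    intro j r hr
    rcases Nat.eq_zero_or_pos r with rfl | hpos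
    · exact ⟨_, const (a ^ j * c), fun z _ _ => by simp⟩
    · refine ⟨_, const 0, fun z _ _ => ?_⟩
      -- For `r > 0` the hypothesis forces `k ≤ j`, so `a ^ j * c` already vanishes.
      rw [pow_zero, mul_one, smul_zero, show j = (j - k) + k by omega, pow_add, mul_assoc, hk,
        mul_zero]
  | succ n ih =>
    intro j r hr
    cases r with
    | zero =>
      exact ⟨_, ((const (a ^ j)).mul (hf.pow (n + 1))).mul (const c), fun z _ _ => by simp⟩
    | succ r =>
      obtain ⟨Θ₁, h1, h1'⟩ := ih (j + 1) (r + 1) (by omega)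
      obtain ⟨Θ₂, h2, h2'⟩ := ih j r (by omega)
      refine ⟨_, add _ _ h1 (hη.mul h2), fun z hz hne => ?_⟩
      have hc : a ^ j * η z = η z * a ^ j := ((hcomm z hz hne).pow_left j).eq
      -- One factor is expanded: its summand `a` increases the power of `a`, and its other summand
      -- supplies a factor `z - z₀`. Either way the inductive bound is preserved.
      have e : a ^ j * (a + ((z : ℚ) - z₀) • η z) ^ (n + 1) * c =
          a ^ (j + 1) * (a + ((z : ℚ) - z₀) • η z) ^ n * c +
          ((z : ℚ) - z₀) • (η z * (a ^ j * (a + ((z : ℚ) - z₀) • η z) ^ n * c)) := by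
        rw [pow_succ' (a + _), ← mul_assoc (a ^ j), mul_add, ← pow_succ, mul_smul_comm, hc, add_mul,
          add_mul, smul_mul_assoc, smul_mul_assoc]
        simp only [mul_assoc]
      rw [e, h1' z hz hne, h2' z hz hne]
      simp only [smul_add, pow_succ', mul_smul, mul_smul_comm]

end IsPolyFun

end PolynomialFunctions

/-! ### Quasi-polynomials of period two -/

section QuasiPolynomials

variable {A : Type*} [AddCommGroup A] [Module ℚ A]

/-- Functions on `ℤ` that are polynomial on each of the two parity classes. -/
def IsQuasiPoly (f : ℤ → A) : Prop :=
  ∀ z₀ : ℤ, ∃ g : ℤ → A, IsPolyFun g ∧ ∀ z, Even (z - z₀) → f z = g z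

namespace IsQuasiPoly

lemma of_even_odd {f g₀ g₁ : ℤ → A} (h₀ : IsPolyFun g₀) (h₁ : IsPolyFun g₁)
    (h₀' : ∀ z, Even z → f z = g₀ z) (h₁' : ∀ z, Odd z → f z = g₁ z) : IsQuasiPoly f := by
  intro z₀
  rcases Int.even_or_odd z₀ with h | h
  · exact ⟨g₀, h₀, fun z hz => h₀' z (by simpa using hz.add h)⟩
  · exact ⟨g₁, h₁, fun z hz => h₁' z (by simpa using hz.add_odd h)⟩

lemma exists_antidifference {f : ℤ → A} (hf : IsQuasiPoly f) :
    ∃ S : ℤ → A, IsQuasiPoly S ∧ S 0 = 0 ∧ ∀ z, S (z + 1) = S z + f z := by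
  classical
  obtain ⟨g₀, h₀, h₀'⟩ := hf 0
  obtain ⟨g₁, h₁, h₁'⟩ := hf 1
  obtain ⟨H, hH, hH'⟩ := (IsPolyFun.add _ _ h₀ (h₁.comp_add 1)).exists_antidifference
  have e₀ : ∀ z, Even z → f z = g₀ z := fun z hz => h₀' z (by simpa using hz)
  have e₁ : ∀ z, Odd z → f z = g₁ z := fun z hz => h₁' z (by simpa using hz.sub_odd odd_one)
  -- `H` sums the values of `f` in pairs beginning at an even point; an odd argument needs one more
  -- single value.
  refine ⟨fun z => if Even z then H z - H 0 else H (z - 1) - H 0 + g₀ (z - 1), ?_, ?_, ?_⟩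
  · refine of_even_odd (hH.sub (.const (H 0)))
      (.add _ _ ((hH.comp_add (-1)).sub (.const (H 0))) (h₀.comp_add (-1))) ?_ ?_
    · intro z hz
      simp [hz]
    · intro z hz
      simp only [if_neg (Int.not_even_iff_odd.2 hz), sub_eq_add_neg]
  · simp
  · intro z
    by_cases hz : Even z
    · have : ¬ Even (z + 1) := by rw [Int.even_add_one]; exact not_not.2 hz
      simp only [if_pos hz, if_neg this, add_sub_cancel_right, e₀ z hz]
    · have h' : Even (z + 1) := by rw [Int.even_add_one]; exact hz
      simp only [if_neg hz, if_pos h', e₁ z (Int.not_even_iff_odd.1 hz)]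
      have := hH' (z - 1)
      rw [sub_add_cancel, show z - 1 + 2 = z + 1 by ring, sub_eq_iff_eq_add] at this
      rw [this]
      abel

variable {B : Type*} [Ring B] [Algebra ℚ B]

lemma mul {f g : ℤ → B} (hf : IsQuasiPoly f) (hg : IsQuasiPoly g) :
    IsQuasiPoly fun z => f z * g z := by
  intro z₀
  obtain ⟨f', h1, h1'⟩ := hf z₀
  obtain ⟨g', h2, h2'⟩ := hg z₀
  exact ⟨_, h1.mul h2, fun z hz => by simp only [h1' z hz, h2' z hz]⟩

end IsQuasiPoly

/-- The leading coefficient of `halfBinom m`. -/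
def halfBinomLead (m : ℕ) : ℚ := (1 / 2) ^ m / m.factorial

lemma halfBinomLead_pos (m : ℕ) : 0 < halfBinomLead m := by
  unfold halfBinomLead; positivity

lemma exists_halfBinom_lead (m : ℕ) : ∃ p : ℚ[X], p.natDegree ≤ m ∧ p.coeff m = halfBinomLead m ∧
    ∀ x, halfBinom m x = p.eval x := by
  have key : ∀ (s : Finset ℕ), (∏ i ∈ s, (C (1 / 2) * X + C ((m : ℚ) / 2 - i))).natDegree ≤ s.card ∧
      (∏ i ∈ s, (C (1 / 2) * X + C ((m : ℚ) / 2 - i))).coeff s.card = (1 / 2) ^ s.card := by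
    intro s
    have h1 : ∀ i ∈ s, (C (1 / 2) * X + C ((m : ℚ) / 2 - i)).natDegree ≤ 1 := fun i _ =>
      natDegree_linear_le
    constructor
    · refine (natDegree_prod_le _ _).trans ((Finset.sum_le_card_nsmul s _ 1 h1).trans ?_)
      simp
    · have := coeff_prod_of_natDegree_le s (fun i : ℕ => C (1 / 2) * X + C ((m : ℚ) / 2 - i)) 1 h1
      rw [mul_one] at this
      rw [this, ← Finset.prod_const]
      refine Finset.prod_congr rfl fun i _ => ?_
      simp
  have k := key (Finset.range m)
  rw [Finset.card_range] at k
  refine ⟨(∏ i ∈ Finset.range m, (C (1 / 2) * X + C ((m : ℚ) / 2 - i))) *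
    C ((m.factorial : ℚ)⁻¹), (natDegree_mul_C_le _ _).trans k.1, ?_, fun x => ?_⟩
  · rw [coeff_mul_C, k.2, halfBinomLead, ← div_eq_mul_inv]
  · rw [halfBinom, eval_mul, eval_prod, eval_C, div_eq_mul_inv]
    congr 1
    refine Finset.prod_congr rfl fun i _ => ?_
    simp only [eval_add, eval_mul, eval_C, eval_X]
    ring

lemma isQuasiPoly_parityBinom_smul (m : ℕ) (c : A) :
    IsQuasiPoly fun z => parityBinom m z • c := by
  obtain ⟨p, -, -, hp⟩ := exists_halfBinom_lead m
  intro z₀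
  by_cases h : Even (z₀ + m)
  · refine ⟨_, .smul p c, fun z hz => ?_⟩
    have : Even (z + m) := by
      have := hz.add h
      rwa [show z - z₀ + (z₀ + m) = z + m by ring] at this
    change parityBinom m z • c = p.eval (z : ℚ) • c
    rw [parityBinom, if_pos this, hp]
  · refine ⟨_, .const 0, fun z hz => ?_⟩
    have : ¬ Even (z + m) := fun h' => h (by
      have := h'.sub hz
      rwa [show z + m - (z - z₀) = z₀ + m by ring] at this)
    change parityBinom m z • c = 0
    rw [parityBinom, if_neg this, zero_smul]

end QuasiPolynomials

/-! ### The point vectors in the exterior algebra -/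

section PointVectors

/-- The vector with coordinates `parityBinom m z`, in the exterior algebra. -/
noncomputable def pointVec (α : ℕ) (z : ℤ) : ExteriorAlgebra ℚ (Fin α → ℚ) :=
  ExteriorAlgebra.ι ℚ fun m => parityBinom m z

lemma pointVec_mul_self (α : ℕ) (z : ℤ) : pointVec α z * pointVec α z = 0 :=
  ExteriorAlgebra.ι_sq_zero _

lemma pointVec_anticomm (α : ℕ) (y z : ℤ) :
    pointVec α y * pointVec α z = -(pointVec α z * pointVec α y) :=
  eq_neg_of_add_eq_zero_left (ExteriorAlgebra.ι_add_mul_swap _ _)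

lemma pointVec_neg_one (α : ℕ) : pointVec α (-1) = 0 := by
  rw [pointVec, show (fun m : Fin α => parityBinom m (-1)) = 0 from
    funext fun m => parityBinom_neg_one m, map_zero]

lemma isQuasiPoly_pointVec (α : ℕ) : IsQuasiPoly (pointVec α) := by
  intro z₀
  choose g hg hg' using fun m : Fin α => isQuasiPoly_parityBinom_smul (m : ℕ)
    (ExteriorAlgebra.ι ℚ (Pi.single m 1 : Fin α → ℚ)) z₀
  refine ⟨_, .sum Finset.univ fun m _ => hg m, fun z hz => ?_⟩
  rw [← Finset.sum_congr rfl fun m _ => hg' m z hz, pointVec,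
    pi_eq_sum_univ' (fun m : Fin α => parityBinom m z), map_sum]
  simp only [map_smul]

/-- The determinant functional of the exterior algebra. -/
noncomputable def topCoeff (α : ℕ) : ExteriorAlgebra ℚ (Fin α → ℚ) →ₗ[ℚ] ℚ :=
  ExteriorAlgebra.liftAlternating fun i =>
    if h : α = i then (Matrix.detRowAlternating (n := Fin α) (R := ℚ)).domDomCongr (finCongr h)
    else 0

lemma topCoeff_orderedProdSum (α : ℕ) (x : ℕ → ℤ) (n : ℕ) :
    topCoeff α (orderedProdSum (fun i => pointVec α (x i)) α n) =
      ∑ l ∈ increasing α n, pointDet fun j => x (l j) := by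
  rw [orderedProdSum, map_sum]
  refine Finset.sum_congr rfl fun l _ => ?_
  have := ExteriorAlgebra.liftAlternating_apply_ιMulti (R := ℚ) (fun i =>
    if h : α = i then (Matrix.detRowAlternating (n := Fin α) (R := ℚ)).domDomCongr (finCongr h)
    else 0) (fun j : Fin α => fun m : Fin α => parityBinom m (x (l j)))
  rw [ExteriorAlgebra.ιMulti_apply] at this
  refine this.trans ?_
  rw [dif_pos rfl]
  rfl

/-- The signed count as a function of the number `n` of available points. -/
def pointDetSum (α n : ℕ) : ℚ := ∑ l ∈ increasing α n, pointDet fun j => (l j : ℤ)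

/-- The index `z`, with negative indices reflected by `z ↦ -1 - z`. -/
def foldIndex (z : ℤ) : ℕ := if 0 ≤ z then z.toNat else (-1 - z).toNat

/-- Running the summation recurrences backwards extends them to negative arguments. Since the vector
at `-1` is zero, the values at `-1` and `0` agree, and each further step down adjoins one of the
points `-2, -3, …`. In the pair sum the minus sign of `s` cancels the one from the backward step. -/
lemma exists_pairSum_extension (α : ℕ) : ∃ s ω : ℤ → ExteriorAlgebra ℚ (Fin α → ℚ),
    IsQuasiPoly s ∧ IsQuasiPoly ω ∧
    (∀ n : ℕ, s n = ∑ i ∈ Finset.range n, pointVec α i) ∧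
    (∀ n : ℕ, ω n = pairSum (fun i => pointVec α i) n) ∧
    (∀ n : ℕ, s (-1 - n) = -∑ i ∈ Finset.range n, pointVec α (-2 - i)) ∧
    (∀ n : ℕ, ω (-1 - n) = pairSum (fun i => pointVec α (-2 - i)) n) := by
  obtain ⟨s, hs, hs0, hs1⟩ := (isQuasiPoly_pointVec α).exists_antidifference
  obtain ⟨ω, hω, hω0, hω1⟩ := (hs.mul (isQuasiPoly_pointVec α)).exists_antidifference
  have p1 : ∀ n : ℕ, s n = ∑ i ∈ Finset.range n, pointVec α i := by
    intro n
    induction n with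
    | zero => simpa using hs0
    | succ n ih =>
      push_cast
      rw [hs1, ih, Finset.sum_range_succ]
  have p2 : ∀ n : ℕ, s (-1 - n) = -∑ i ∈ Finset.range n, pointVec α (-2 - i) := by
    intro n
    induction n with
    | zero =>
      have := hs1 (-1)
      rw [pointVec_neg_one, neg_add_cancel, hs0, add_zero] at this
      simpa using this.symm
    | succ n ih =>
      have := hs1 (-2 - n)
      rw [show (-2 - (n : ℤ) + 1) = -1 - n by ring, ih] at this
      push_cast
      rw [Finset.sum_range_succ, show (-1 - ((n : ℤ) + 1)) = -2 - n by ring, neg_add, this]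
      abel
  refine ⟨s, ω, hs, hω, p1, fun n => ?_, p2, fun n => ?_⟩
  · induction n with
    | zero => simpa [pairSum] using hω0
    | succ n ih =>
      push_cast
      rw [hω1, ih, p1, pairSum, pairSum, Finset.sum_range_succ]
  · induction n with
    | zero =>
      have := hω1 (-1)
      rw [pointVec_neg_one, neg_add_cancel, hω0, mul_zero, add_zero] at this
      simpa [pairSum] using this.symm
    | succ n ih =>
      have := hω1 (-2 - n)
      have e := p2 (n + 1)
      push_cast at e
      rw [show (-1 - ((n : ℤ) + 1)) = -2 - n by ring, Finset.sum_range_succ] at e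
      rw [show (-2 - (n : ℤ) + 1) = -1 - n by ring, ih, e, neg_mul, add_mul, pointVec_mul_self,
        add_zero] at this
      push_cast
      rw [show (-1 - ((n : ℤ) + 1)) = -2 - n by ring, pairSum, Finset.sum_range_succ, ← pairSum,
        this]
      abel

end PointVectors

/-! ### Multiplicity of the integer roots -/

section Divisibility

lemma Polynomial.eq_of_eval_natCast_eq {p q : ℚ[X]} (z₀ : ℤ)
    (h : ∀ N : ℕ, Even ((N : ℤ) - z₀) → (N : ℤ) ≠ z₀ → p.eval (N : ℚ) = q.eval (N : ℚ)) :
    p = q := by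
  refine eq_of_infinite_eval_eq p q (Set.infinite_of_injective_forall_mem
    -- These arguments have the parity of `z₀` and exceed it.
    (f := fun n : ℕ => ((2 * (n + 1) + z₀.natAbs : ℕ) : ℚ)) (fun a b hab => ?_) fun n => ?_)
  · have : 2 * (a + 1) + z₀.natAbs = 2 * (b + 1) + z₀.natAbs := Nat.cast_injective (R := ℚ) hab
    omega
  · have ha := Int.natAbs_eq z₀
    generalize z₀.natAbs = a at ha ⊢
    refine h _ ?_ ?_
    · rcases ha with ha | ha
      · exact ⟨n + 1, by push_cast; omega⟩
      · exact ⟨n + 1 - z₀, by push_cast; omega⟩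
    · push_cast; omega

lemma eq_neg_one_sub_foldIndex {z : ℤ} (h : ¬ 0 ≤ z) : z = -1 - (foldIndex z : ℤ) := by
  rw [foldIndex, if_neg h]; omega

lemma eq_foldIndex {z : ℤ} (h : 0 ≤ z) : z = (foldIndex z : ℤ) := by
  rw [foldIndex, if_pos h]; omega

/-- On the parity class of `z₀` one has `ω z = ω z₀ + (z - z₀) • η z`. Nilpotency of `ω z₀` forces
many factors of the second kind in the expanded power. In the product with `s`, the part `s z₀` is
killed by a smaller power of `ω z₀`, and the remainder of `s` brings its own factor `z - z₀`. -/
lemma exists_parityClass_factor {α : ℕ} {n : ℕ} {s ω : ℤ → ExteriorAlgebra ℚ (Fin α → ℚ)}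
    (hs : IsQuasiPoly s) (hω : IsQuasiPoly ω) (hcomm : ∀ y z, Commute (ω y) (ω z)) (z₀ : ℤ) (r : ℕ)
    (h1 : ∀ k, foldIndex z₀ < 2 * k → ω z₀ ^ k = 0)
    (h2 : ∀ k, foldIndex z₀ < 2 * k + 1 → ω z₀ ^ k * s z₀ = 0) :
    (2 * r + foldIndex z₀ ≤ 2 * n + 1 → ∃ Θ : ℤ → ExteriorAlgebra ℚ (Fin α → ℚ), IsPolyFun Θ ∧
      ∀ z, Even (z - z₀) → z ≠ z₀ → ω z ^ n = ((z : ℚ) - z₀) ^ r • Θ z) ∧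
    (2 * r + foldIndex z₀ ≤ 2 * n + 2 → ∃ Θ : ℤ → ExteriorAlgebra ℚ (Fin α → ℚ), IsPolyFun Θ ∧
      ∀ z, Even (z - z₀) → z ≠ z₀ → ω z ^ n * s z = ((z : ℚ) - z₀) ^ r • Θ z) := by
  obtain ⟨g, hg, hg'⟩ := hω z₀
  obtain ⟨η, hη, hη'⟩ := hg.exists_eq_add_smul z₀
  obtain ⟨g₁, hg₁, hg₁'⟩ := hs z₀
  obtain ⟨σ, hσ, hσ'⟩ := hg₁.exists_eq_add_smul z₀
  have even0 : Even (z₀ - z₀) := by simp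
  rw [← hg' z₀ even0] at hη'
  rw [← hg₁' z₀ even0] at hσ'
  -- Away from `z₀`, `η z` is a scalar multiple of `ω z - ω z₀`, so commutation is inherited from
  -- `ω`.
  have hc : ∀ z, Even (z - z₀) → z ≠ z₀ → Commute (ω z₀) (η z) := by
    intro z hz hne
    have hne' : ((z : ℚ) - z₀) ≠ 0 := sub_ne_zero.2 (by exact_mod_cast hne)
    have : η z = ((z : ℚ) - z₀)⁻¹ • (ω z - ω z₀) := by
      rw [hg' z hz, hη' z, add_sub_cancel_left, smul_smul, inv_mul_cancel₀ hne', one_smul]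
    rw [this]
    exact ((hcomm z₀ z).sub_right (hcomm z₀ z₀)).smul_right _
  have key : ∀ (c : ExteriorAlgebra ℚ (Fin α → ℚ)) (k r : ℕ), ω z₀ ^ k * c = 0 → r + k ≤ n + 1 →
      ∃ Θ : ℤ → ExteriorAlgebra ℚ (Fin α → ℚ), IsPolyFun Θ ∧
        ∀ z, Even (z - z₀) → z ≠ z₀ → ω z ^ n * c = ((z : ℚ) - z₀) ^ r • Θ z := by
    intro c k r hk hr
    obtain ⟨Θ, hΘ, hΘ'⟩ := IsPolyFun.exists_pow_mul_eq hη z₀ hc hk n 0 r (by omega)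
    refine ⟨Θ, hΘ, fun z hz hne => ?_⟩
    rw [← hΘ' z hz hne, pow_zero, one_mul, hg' z hz, hη' z]
  constructor
  · intro hr
    obtain ⟨Θ, hΘ, hΘ'⟩ := key 1 (n + 1 - r) r (by rw [h1 _ (by omega), zero_mul]) (by omega)
    exact ⟨Θ, hΘ, fun z hz hne => by rw [← hΘ' z hz hne, mul_one]⟩
  · intro hr
    cases r with
    | zero =>
      exact ⟨_, (hg.pow n).mul hg₁, fun z hz _ => by
        rw [pow_zero, one_smul, hg' z hz, hg₁' z hz]⟩
    | succ r =>
      obtain ⟨Θ, hΘ, hΘ'⟩ := key (s z₀) (n - r) (r + 1) (h2 _ (by omega)) (by omega)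
      obtain ⟨Ξ, hΞ, hΞ'⟩ := key 1 (n + 1 - r) r (by rw [h1 _ (by omega), zero_mul]) (by omega)
      refine ⟨_, .add _ _ hΘ (hΞ.mul hσ), fun z hz hne => ?_⟩
      have h3 := hΞ' z hz hne
      rw [mul_one] at h3
      rw [hg₁' z hz, hσ' z, mul_add, hΘ' z hz hne, smul_add, h3, smul_mul_smul_comm, ← pow_succ]

/-- Up to a factorial, `P` is the determinant functional applied to `ω ^ n` or `ω ^ n * s`. At `z₀`
these are built from `foldIndex z₀` square-zero anticommuting vectors, so products of more of them
vanish; every two missing vectors cost one factor `z - z₀`. -/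
theorem X_sub_C_pow_dvd_of_eq_pointDetSum {α : ℕ} {P : ℚ[X]} {z₀ : ℤ}
    (hP : ∀ N : ℕ, Even ((N : ℤ) - z₀) → pointDetSum α N = P.eval (N : ℚ)) {r : ℕ}
    (hr : 2 * r + foldIndex z₀ ≤ α + 1) : (X - C (z₀ : ℚ)) ^ r ∣ P := by
  obtain ⟨s, ω, hs, hω, s1, ω1, s2, ω2⟩ := exists_pairSum_extension α
  have hcv : ∀ y z, Commute (ω y) (pointVec α z) := by
    intro y z
    by_cases h : 0 ≤ y
    · rw [eq_foldIndex h, ω1]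
      exact pairSum_commute (fun i => pointVec_anticomm _ _ _) _
    · rw [eq_neg_one_sub_foldIndex h, ω2]
      exact pairSum_commute (fun i => pointVec_anticomm _ _ _) _
  have hpair : ∀ (x : ExteriorAlgebra ℚ (Fin α → ℚ)) (f : ℕ → ExteriorAlgebra ℚ (Fin α → ℚ)),
      (∀ i, Commute x (f i)) → ∀ n, Commute x (pairSum f n) := fun x f hf n =>
    Commute.sum_right _ _ _ fun j _ =>
      (Commute.sum_right _ _ _ fun i _ => hf i).mul_right (hf j)
  have hcomm : ∀ y z, Commute (ω y) (ω z) := by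
    intro y z
    by_cases h : 0 ≤ z
    · rw [eq_foldIndex h, ω1]
      exact hpair _ _ (fun i => hcv y i) _
    · rw [eq_neg_one_sub_foldIndex h, ω2]
      exact hpair _ _ (fun i => hcv y _) _
  have h1 : ∀ k, foldIndex z₀ < 2 * k → ω z₀ ^ k = 0 := by
    intro k hk
    by_cases h : 0 ≤ z₀
    · rw [eq_foldIndex h, ω1]
      exact pairSum_pow_eq_zero (fun i j => pointVec_anticomm _ _ _)
        (fun i => pointVec_mul_self _ _) hk
    · rw [eq_neg_one_sub_foldIndex h, ω2]
      exact pairSum_pow_eq_zero (fun i j => pointVec_anticomm _ _ _)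
        (fun i => pointVec_mul_self _ _) hk
  have h2 : ∀ k, foldIndex z₀ < 2 * k + 1 → ω z₀ ^ k * s z₀ = 0 := by
    intro k hk
    by_cases h : 0 ≤ z₀
    · rw [eq_foldIndex h, ω1, s1]
      exact pairSum_pow_mul_sum_eq_zero (e := fun i => pointVec α i)
        (fun i j => pointVec_anticomm _ _ _) (fun i => pointVec_mul_self _ _) hk
    · rw [eq_neg_one_sub_foldIndex h, ω2, s2, mul_neg, neg_eq_zero]
      exact pairSum_pow_mul_sum_eq_zero (e := fun i : ℕ => pointVec α (-2 - i))
        (fun i j => pointVec_anticomm _ _ _) (fun i => pointVec_mul_self _ _) hk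
  have fin : ∀ (n : ℕ) (Θ : ℤ → ExteriorAlgebra ℚ (Fin α → ℚ)), IsPolyFun Θ →
      (∀ N : ℕ, Even ((N : ℤ) - z₀) → (N : ℤ) ≠ z₀ →
        n.factorial • orderedProdSum (fun i => pointVec α i) α N = ((N : ℚ) - z₀) ^ r • Θ N) →
      (X - C (z₀ : ℚ)) ^ r ∣ P := by
    intro n Θ hΘ h
    obtain ⟨p, hp⟩ := (hΘ.map (topCoeff α)).exists_polynomial
    have hn : (n.factorial : ℚ) ≠ 0 := by exact_mod_cast n.factorial_ne_zero
    have : C (n.factorial : ℚ) * P = (X - C (z₀ : ℚ)) ^ r * p := by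
      refine Polynomial.eq_of_eval_natCast_eq z₀ fun N hN hne => ?_
      have e := congrArg (topCoeff α) (h N hN hne)
      rw [map_nsmul, topCoeff_orderedProdSum α (fun i => (i : ℤ)), map_smul, hp] at e
      rw [eval_mul, eval_mul, eval_C, ← hP N hN, eval_pow, eval_sub, eval_X, eval_C, pointDetSum]
      simpa using e
    have hu : IsUnit (C (n.factorial : ℚ)) := isUnit_C.2 hn.isUnit
    exact (hu.dvd_mul_left).1 ⟨p, this⟩
  rcases Nat.even_or_odd' α with ⟨n, hα | hα⟩
  · obtain ⟨Θ, hΘ, hΘ'⟩ := (exists_parityClass_factor (n := n) hs hω hcomm z₀ r h1 h2).1 (by omega)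
    refine fin n Θ hΘ fun N hN hne => ?_
    have := (factorial_nsmul_orderedProdSum (e := fun i => pointVec α i)
      (fun i j => pointVec_anticomm _ _ _) (fun i => pointVec_mul_self _ _) N n).1
    rw [← ω1, hΘ' N hN hne, ← hα] at this
    exact_mod_cast this
  · obtain ⟨Θ, hΘ, hΘ'⟩ := (exists_parityClass_factor (n := n) hs hω hcomm z₀ r h1 h2).2 (by omega)
    refine fin n Θ hΘ fun N hN hne => ?_
    have := (factorial_nsmul_orderedProdSum (e := fun i => pointVec α i)
      (fun i j => pointVec_anticomm _ _ _) (fun i => pointVec_mul_self _ _) N n).2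
    rw [← ω1, ← s1, hΘ' N hN hne, ← hα] at this
    exact_mod_cast this

/-- Reciprocity: the polynomial for one parity class, at `-1 - n`, is up to sign the count at `n`. -/
theorem eval_neg_one_sub_of_eq_pointDetSum {m : ℕ} {P : ℚ[X]} (n : ℕ)
    (hP : ∀ N : ℕ, Even ((N : ℤ) - (-1 - n)) → pointDetSum (2 * m) N = P.eval (N : ℚ)) :
    P.eval (-1 - n : ℚ) = (∏ i : Fin (2 * m), (-1) ^ (i : ℕ)) * pointDetSum (2 * m) n := by
  obtain ⟨s, ω, hs, hω, s1, ω1, s2, ω2⟩ := exists_pairSum_extension (2 * m)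
  obtain ⟨g, hg, hg'⟩ := hω (-1 - n)
  obtain ⟨p, hp⟩ := ((hg.pow m).map (topCoeff (2 * m))).exists_polynomial
  have hm : (m.factorial : ℚ) ≠ 0 := by exact_mod_cast m.factorial_ne_zero
  have hPp : C (m.factorial : ℚ) * P = p := by
    refine Polynomial.eq_of_eval_natCast_eq (-1 - n) fun N hN _ => ?_
    have e := (factorial_nsmul_orderedProdSum (e := fun i => pointVec (2 * m) i)
      (fun i j => pointVec_anticomm _ _ _) (fun i => pointVec_mul_self _ _) N m).1
    rw [← ω1, hg' N hN] at e
    have e := congrArg (topCoeff (2 * m)) e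
    rw [map_nsmul, topCoeff_orderedProdSum (2 * m) (fun i => (i : ℤ)), hp] at e
    rw [eval_mul, eval_C, ← hP N hN, pointDetSum]
    simpa using e
  have e := (factorial_nsmul_orderedProdSum (e := fun i : ℕ => pointVec (2 * m) (-2 - i))
    (fun i j => pointVec_anticomm _ _ _) (fun i => pointVec_mul_self _ _) n m).1
  rw [← ω2, hg' _ (by simp)] at e
  have e := congrArg (topCoeff (2 * m)) e
  rw [map_nsmul, topCoeff_orderedProdSum (2 * m) (fun i => -2 - (i : ℤ)), hp, ← hPp, eval_mul,
    eval_C, nsmul_eq_mul] at e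
  have e := mul_left_cancel₀ hm e
  push_cast at e
  rw [← e, pointDetSum, Finset.mul_sum]
  refine Finset.sum_congr rfl fun l _ => ?_
  simp only [pointDet]
  -- Reflecting all points multiplies column `i` by `(-1) ^ i`.
  rw [← Matrix.det_mul_row]
  congr 1
  ext j i
  simp [parityBinom_reflect]

end Divisibility

/-! ### Leading coefficients of nested sums -/

section LeadingCoefficient

/-- `f` is given on the even and on the odd naturals by polynomials of degree at most `d` with the
coefficient `c` at degree `d`. -/
def HasLeading (f : ℕ → ℚ) (d : ℕ) (c : ℚ) : Prop :=
  ∀ ε : ℕ, ∃ p : ℚ[X], p.natDegree ≤ d ∧ p.coeff d = c ∧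
    ∀ n : ℕ, n % 2 = ε % 2 → f n = p.eval (n : ℚ)

lemma HasLeading.const_mul {f : ℕ → ℚ} {d : ℕ} {c : ℚ} (hf : HasLeading f d c) (a : ℚ) :
    HasLeading (fun n => a * f n) d (a * c) := by
  intro ε
  obtain ⟨p, h1, h2, h3⟩ := hf ε
  exact ⟨C a * p, (natDegree_C_mul_le a p).trans h1, by rw [coeff_C_mul, h2], fun n hn => by
    simp only [h3 n hn, eval_mul, eval_C]⟩

lemma HasLeading.sum {ι : Type*} (s : Finset ι) {f : ι → ℕ → ℚ} {d : ℕ} {c : ι → ℚ}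
    (hf : ∀ i ∈ s, HasLeading (f i) d (c i)) :
    HasLeading (fun n => ∑ i ∈ s, f i n) d (∑ i ∈ s, c i) := by
  classical
  induction s using Finset.induction_on with
  | empty => exact fun ε => ⟨0, by simp, by simp, by simp⟩
  | insert a s ha ih =>
    intro ε
    obtain ⟨p, h1, h2, h3⟩ := hf a (Finset.mem_insert_self a s) ε
    obtain ⟨q, h4, h5, h6⟩ := ih (fun i hi => hf i (Finset.mem_insert_of_mem hi)) ε
    refine ⟨p + q, natDegree_add_le_of_degree_le h1 h4, ?_, fun n hn => ?_⟩
    · rw [coeff_add, h2, h5, Finset.sum_insert ha]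
    · simp only [Finset.sum_insert ha, eval_add, ← h3 n hn, ← h6 n hn]

/-- Over two steps `T` grows by one value from each class, so only the sum of the two coefficients
matters. The odd class differs from the even one by a single term of degree at most `d`, hence both
classes have the same coefficient at degree `d + 1`. -/
lemma HasLeading.of_sum {f T : ℕ → ℚ} (hT : ∀ n, T (n + 1) = T n + f n) (hT0 : T 0 = 0)
    {d : ℕ} {p₀ p₁ : ℚ[X]} (h₀ : p₀.natDegree ≤ d) (h₁ : p₁.natDegree ≤ d)
    (hf₀ : ∀ n, n % 2 = 0 → f n = p₀.eval (n : ℚ)) (hf₁ : ∀ n, n % 2 = 1 → f n = p₁.eval (n : ℚ)) :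
    HasLeading T (d + 1) ((p₀.coeff d + p₁.coeff d) / (2 * (d + 1))) := by
  have hd : (p₁.comp (X + C 1)).natDegree ≤ d := by
    rw [natDegree_comp, natDegree_X_add_C, mul_one]; exact h₁
  have hcoeff : ∀ (p : ℚ[X]) (n : ℕ) (r : ℚ), p.natDegree ≤ n →
      (p.comp (X + C r)).coeff n = p.coeff n := by
    intro p n r hp
    rcases hp.eq_or_lt with rfl | hp
    · have := coeff_comp_degree_mul_degree (p := p) (q := X + C r)
        (by rw [natDegree_X_add_C]; exact one_ne_zero)
      rw [natDegree_X_add_C, mul_one, leadingCoeff_X_add_C, one_pow, mul_one] at this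
      exact this
    · rw [coeff_eq_zero_of_natDegree_lt hp, coeff_eq_zero_of_natDegree_lt]
      rwa [natDegree_comp, natDegree_X_add_C, mul_one]
  obtain ⟨Q, hQ1, hQ2, hQ3⟩ := exists_two_step_antidifference (d + 1) (p₀ + p₁.comp (X + C 1))
    fun k hk => coeff_eq_zero_of_natDegree_lt
      (lt_of_le_of_lt (natDegree_add_le_of_degree_le h₀ hd) hk)
  have hQd : Q.natDegree ≤ d + 1 := natDegree_le_iff_coeff_eq_zero.2 fun k hk => hQ1 k hk
  have hQc : Q.coeff (d + 1) = (p₀.coeff d + p₁.coeff d) / (2 * (d + 1)) := by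
    rw [hQ2 d rfl, coeff_add, hcoeff _ _ _ h₁]
  have heven : ∀ n : ℕ, T (2 * n) = Q.eval ((2 * n : ℕ) : ℚ) - Q.eval 0 := by
    intro n
    induction n with
    | zero => simp [hT0]
    | succ n ih =>
      rw [show 2 * (n + 1) = 2 * n + 1 + 1 by ring, hT, hT, ih, hf₀ _ (by omega),
        hf₁ _ (by omega)]
      have := hQ3 ((2 * n : ℕ) : ℚ)
      rw [eval_add, eval_comp, eval_add, eval_X, eval_C] at this
      push_cast at this ⊢
      rw [show (2 * n + 1 + 1 : ℚ) = 2 * n + 2 by ring]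
      linear_combination -this
  intro ε
  rcases Nat.mod_two_eq_zero_or_one ε with hε | hε
  · refine ⟨Q - C (Q.eval 0), ?_, ?_, fun n hn => ?_⟩
    · rw [natDegree_sub_C]; exact hQd
    · rw [coeff_sub, coeff_C_succ, sub_zero, hQc]
    · obtain ⟨k, rfl⟩ : ∃ k, n = 2 * k := ⟨n / 2, by omega⟩
      rw [heven, eval_sub, eval_C]
  · refine ⟨Q.comp (X + C (-1)) - C (Q.eval 0) + p₀.comp (X + C (-1)), ?_, ?_, fun n hn => ?_⟩
    · refine natDegree_add_le_of_degree_le ?_ ?_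
      · rw [natDegree_sub_C, natDegree_comp, natDegree_X_add_C, mul_one]; exact hQd
      · rw [natDegree_comp, natDegree_X_add_C, mul_one]; omega
    · have h0 : (p₀.comp (X + C (-1))).coeff (d + 1) = 0 := by
        rw [hcoeff _ _ _ (h₀.trans (Nat.le_succ d)), coeff_eq_zero_of_natDegree_lt (by omega)]
      rw [coeff_add, coeff_sub, coeff_C_succ, sub_zero, hcoeff _ _ _ hQd, hQc, h0, add_zero]
    · obtain ⟨k, rfl⟩ : ∃ k, n = 2 * k + 1 := ⟨n / 2, by omega⟩
      rw [hT, heven, hf₀ _ (by omega)]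
      simp [eval_comp]

/-- The nested sum of `∏ j, f j (l j)` over increasing `l`. -/
def nestedSum {k : ℕ} (f : Fin k → ℕ → ℚ) (n : ℕ) : ℚ := ∑ l ∈ increasing k n, ∏ j, f j (l j)

lemma nestedSum_succ_succ {k : ℕ} (f : Fin (k + 1) → ℕ → ℚ) (n : ℕ) :
    nestedSum f (n + 1) = nestedSum f n +
      nestedSum (fun j : Fin k => f j.castSucc) n * f (Fin.last k) n := by
  rw [nestedSum, sum_increasing_succ, nestedSum, nestedSum, Finset.sum_mul]
  congr 1
  refine Finset.sum_congr rfl fun l _ => ?_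
  rw [Fin.prod_univ_castSucc]
  simp

/-- Nested sums of `parityBinom` and of the monomials that are their averages have the same leading
coefficient. -/
lemma exists_hasLeading_nestedSum : ∀ {k : ℕ} (μ : Fin k → ℕ), ∃ c : ℚ,
    HasLeading (nestedSum fun j n => parityBinom (μ j) n) (∑ j, (μ j + 1)) c ∧
    HasLeading (nestedSum fun j n => halfBinomLead (μ j) / 2 * (n : ℚ) ^ μ j) (∑ j, (μ j + 1)) c := by
  intro k
  induction k with
  | zero =>
    intro μ
    refine ⟨1, fun ε => ⟨1, by simp, by simp, fun n _ => ?_⟩, fun ε => ⟨1, by simp, by simp,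
      fun n _ => ?_⟩⟩ <;> simp [nestedSum, increasing_zero]
  | succ k ih =>
    intro μ
    obtain ⟨c, h1, h2⟩ := ih fun j => μ j.castSucc
    set m := μ (Fin.last k) with hm
    set D := ∑ j : Fin k, (μ j.castSucc + 1) with hD
    have hsum : ∑ j, (μ j + 1) = D + m + 1 := by rw [Fin.sum_univ_castSucc, ← hD, ← hm]; ring
    have hz : ∀ f : Fin (k + 1) → ℕ → ℚ, nestedSum f 0 = 0 := fun f => by
      simp [nestedSum, increasing_succ_zero]
    rw [hsum]
    refine ⟨c * halfBinomLead m / (2 * ((D + m : ℕ) + 1)), ?_, ?_⟩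
    · obtain ⟨b, b1, b2, b3⟩ := exists_halfBinom_lead m
      obtain ⟨p, p1, p2, p3⟩ := h1 m
      have hdeg : (p * b).natDegree ≤ D + m := natDegree_mul_le_of_le p1 b1
      have hco : (p * b).coeff (D + m) = c * halfBinomLead m := by
        rw [coeff_mul_add_eq_of_natDegree_le p1 b1, p2, b2]
      have val : ∀ n : ℕ, n % 2 = m % 2 → nestedSum (fun (j : Fin k) n =>
          parityBinom (μ j.castSucc) n) n * parityBinom m n = (p * b).eval (n : ℚ) := by
        intro n hn
        rw [p3 n hn, eval_mul, ← b3, parityBinom, if_pos]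
        · rfl
        · exact_mod_cast Nat.even_iff.2 (by omega)
      have val0 : ∀ n : ℕ, n % 2 ≠ m % 2 → nestedSum (fun (j : Fin k) n =>
          parityBinom (μ j.castSucc) n) n * parityBinom m n = (0 : ℚ[X]).eval (n : ℚ) := by
        intro n hn
        rw [parityBinom, if_neg, mul_zero, eval_zero]
        intro h
        have : Even (n + m) := by exact_mod_cast h
        rw [Nat.even_iff] at this
        omega
      -- The summand lives on the class of `m` only, with coefficient `c * halfBinomLead m`. The
      -- averaged monomial has half of this on both classes, so the sums agree to leading order.
      rcases Nat.mod_two_eq_zero_or_one m with hm2 | hm2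
      · have := HasLeading.of_sum (nestedSum_succ_succ fun j n => parityBinom (μ j) n) (hz _) hdeg
          (natDegree_zero.trans_le (Nat.zero_le _)) (fun n hn => val n (by omega))
          (fun n hn => val0 n (by omega))
        rwa [coeff_zero, add_zero, hco] at this
      · have := HasLeading.of_sum (nestedSum_succ_succ fun j n => parityBinom (μ j) n) (hz _)
          (natDegree_zero.trans_le (Nat.zero_le _)) hdeg (fun n hn => val0 n (by omega))
          (fun n hn => val n (by omega))
        rwa [coeff_zero, zero_add, hco] at this
    · obtain ⟨p, p1, p2, p3⟩ := h2 0
      obtain ⟨q, q1, q2, q3⟩ := h2 1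
      have b1 : (C (halfBinomLead m / 2) * X ^ m : ℚ[X]).natDegree ≤ m := natDegree_C_mul_X_pow_le _ _
      have := HasLeading.of_sum (nestedSum_succ_succ
          fun j n => halfBinomLead (μ j) / 2 * (n : ℚ) ^ μ j) (hz _)
        (natDegree_mul_le_of_le p1 b1) (natDegree_mul_le_of_le q1 b1)
        (fun n hn => by rw [p3 n hn]; simp [hm]) (fun n hn => by rw [q3 n hn]; simp [hm])
      rw [coeff_mul_add_eq_of_natDegree_le p1 b1, coeff_mul_add_eq_of_natDegree_le q1 b1, p2, q2,
        coeff_C_mul_X_pow, if_pos rfl] at this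
      convert this using 2
      ring

end LeadingCoefficient

/-! ### Exact degree of the determinant sum -/

section DegreeOfPointDetSum

lemma sum_increasing_det_eq_sum_perm {α : ℕ} (w : ℕ → ℕ → ℚ) (n : ℕ) :
    ∑ l ∈ increasing α n, (Matrix.of fun j m : Fin α => w m (l j)).det =
      ∑ σ : Equiv.Perm (Fin α), (Equiv.Perm.sign σ : ℚ) * nestedSum (fun j => w (σ j)) n := by
  simp only [nestedSum, Finset.mul_sum]
  rw [Finset.sum_comm]
  refine Finset.sum_congr rfl fun l _ => ?_
  rw [← Matrix.det_transpose, Matrix.det_apply']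
  rfl

lemma det_monomials {α : ℕ} (κ : ℕ → ℚ) (l : Fin α → ℕ) :
    (Matrix.of fun j m : Fin α => κ m * (l j : ℚ) ^ (m : ℕ)).det =
      (∏ m : Fin α, κ m) * ∏ i : Fin α, ∏ j ∈ Finset.Ioi i, ((l j : ℚ) - l i) := by
  rw [← Matrix.det_vandermonde, ← Matrix.det_mul_row]
  rfl

lemma sum_Ioi_card_add_one (α : ℕ) :
    ∑ i : Fin α, ((Finset.Ioi i).card + 1) = ∑ j : Fin α, ((j : ℕ) + 1) := by
  rw [← Equiv.sum_comp Fin.revPerm]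
  refine Finset.sum_congr rfl fun i _ => ?_
  rw [Fin.card_Ioi, Fin.revPerm_apply, Fin.val_rev]
  omega

/-- All terms are nonnegative, so it suffices to keep the tuples with `l j` in the window `[2jM, (2j
+ 1)M)`. There are `M ^ α` of them, and all their differences are at least `M`. -/
lemma pow_le_sum_increasing_vandermonde (α M : ℕ) :
    (M : ℚ) ^ (∑ j : Fin α, ((j : ℕ) + 1)) ≤
      ∑ l ∈ increasing α (2 * (α * M)), ∏ i : Fin α, ∏ j ∈ Finset.Ioi i, ((l j : ℚ) - l i) := by
  classical
  let f : (Fin α → ℕ) → Fin α → ℕ := fun r j => 2 * j * M + r j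
  have hinj : Function.Injective f := by
    intro a b hab
    funext j
    have := congrFun hab j
    simp only [f] at this
    omega
  have hgap : ∀ r ∈ Fintype.piFinset (fun _ : Fin α => Finset.range M), ∀ i j : Fin α, i < j →
      f r i + M ≤ f r j := by
    intro r hr i j hij
    have hri : r i < M := by simpa using Fintype.mem_piFinset.1 hr i
    have hij' : (i : ℕ) + 1 ≤ j := hij
    have := Nat.mul_le_mul_right M hij'
    simp only [f]
    nlinarith
  have hsub : (Fintype.piFinset fun _ : Fin α => Finset.range M).image f ⊆
      increasing α (2 * (α * M)) := by
    intro l hl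
    obtain ⟨r, hr, rfl⟩ := Finset.mem_image.1 hl
    refine mem_increasing.2 ⟨fun j => ?_, fun i j hij => ?_⟩
    · have hrj : r j < M := by simpa using Fintype.mem_piFinset.1 hr j
      have := Nat.mul_le_mul_right M (show (j : ℕ) + 1 ≤ α from j.2)
      simp only [f]
      nlinarith
    · have hri : r i < M := by simpa using Fintype.mem_piFinset.1 hr i
      have := hgap r hr i j hij
      omega
  have hnonneg : ∀ l ∈ increasing α (2 * (α * M)), l ∉ (Fintype.piFinset fun _ : Fin α =>
      Finset.range M).image f → 0 ≤ ∏ i : Fin α, ∏ j ∈ Finset.Ioi i, ((l j : ℚ) - l i) := by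
    intro l hl _
    refine Finset.prod_nonneg fun i _ => Finset.prod_nonneg fun j hj => sub_nonneg.2 ?_
    exact_mod_cast ((mem_increasing.1 hl).2 (Finset.mem_Ioi.1 hj)).le
  refine le_trans ?_ (Finset.sum_le_sum_of_subset_of_nonneg hsub hnonneg)
  rw [Finset.sum_image hinj.injOn]
  have hterm : ∀ r ∈ Fintype.piFinset (fun _ : Fin α => Finset.range M),
      ∏ i : Fin α, (M : ℚ) ^ (Finset.Ioi i).card ≤
        ∏ i : Fin α, ∏ j ∈ Finset.Ioi i, ((f r j : ℚ) - f r i) := by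
    intro r hr
    refine Finset.prod_le_prod (fun i _ => by positivity) fun i _ => ?_
    rw [← Finset.prod_const]
    refine Finset.prod_le_prod (fun j _ => by positivity) fun j hj => ?_
    rw [le_sub_iff_add_le]
    have := hgap r hr i j (Finset.mem_Ioi.1 hj)
    rw [add_comm]
    exact_mod_cast this
  refine le_trans (le_of_eq ?_) (Finset.card_nsmul_le_sum _ _ _ hterm)
  rw [Fintype.card_piFinset, Finset.prod_const, Finset.card_range, Finset.card_univ,
    Fintype.card_fin, nsmul_eq_mul, Finset.prod_pow_eq_pow_sum, Nat.cast_pow, ← pow_add,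
    ← sum_Ioi_card_add_one, Finset.sum_add_distrib]
  simp [add_comm]

/-- The Leibniz expansion reduces the leading coefficient to nested sums, where monomials may
replace parity binomials. If it were zero, the sum of Vandermonde products would have degree below
`D`, against its lower bound of order `M ^ D`. -/
theorem exists_hasLeading_pointDetSum (α : ℕ) (hα : 1 ≤ α) :
    ∃ c : ℚ, c ≠ 0 ∧ HasLeading (pointDetSum α) (∑ j : Fin α, ((j : ℕ) + 1)) c := by
  choose c hw hv using fun σ : Equiv.Perm (Fin α) =>
    exists_hasLeading_nestedSum fun j : Fin α => ((σ j : Fin α) : ℕ)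
  have hdeg : ∀ σ : Equiv.Perm (Fin α), ∑ j, (((σ j : Fin α) : ℕ) + 1) =
      ∑ j : Fin α, ((j : ℕ) + 1) := fun σ => Equiv.sum_comp σ fun j : Fin α => (j : ℕ) + 1
  simp only [hdeg] at hw hv
  set D := ∑ j : Fin α, ((j : ℕ) + 1) with hD
  have hDpos : 0 < D := by
    refine Finset.sum_pos (fun _ _ => Nat.succ_pos _) ⟨⟨0, hα⟩, Finset.mem_univ _⟩
  refine ⟨∑ σ, (Equiv.Perm.sign σ : ℚ) * c σ, ?_, ?_⟩
  · intro hzero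
    have hG := HasLeading.sum Finset.univ fun σ _ => (hv σ).const_mul (Equiv.Perm.sign σ : ℚ)
    rw [hzero] at hG
    obtain ⟨p, p1, p2, p3⟩ := hG 0
    set K : ℚ := ∏ m : Fin α, halfBinomLead m / 2 with hK
    have hKpos : 0 < K := Finset.prod_pos fun m _ => half_pos (halfBinomLead_pos _)
    have bound : ∀ M : ℕ, K * (M : ℚ) ^ D ≤ p.eval (2 * α * M : ℚ) := by
      intro M
      have e := (sum_increasing_det_eq_sum_perm (fun m n => halfBinomLead m / 2 * (n : ℚ) ^ m)
        (2 * (α * M))).trans (p3 (2 * (α * M)) (by omega))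
      have e' : ((2 * (α * M) : ℕ) : ℚ) = 2 * α * M := by push_cast; ring
      rw [e'] at e
      rw [← e, Finset.sum_congr rfl fun l _ => det_monomials (fun m => halfBinomLead m / 2) l,
        ← Finset.mul_sum]
      exact mul_le_mul_of_nonneg_left (pow_le_sum_increasing_vandermonde α M) hKpos.le
    set q : ℚ[X] := p.comp (C (2 * α : ℚ) * X) with hq
    have hα0 : (2 * α : ℚ) ≠ 0 := by
      have : (α : ℚ) ≠ 0 := by exact_mod_cast (by omega : α ≠ 0)
      positivity
    have hqc : ∀ k, D ≤ k → q.coeff k = 0 := by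
      intro k hk
      rw [hq, comp_C_mul_X_coeff]
      rcases hk.eq_or_lt with rfl | hk
      · rw [p2, zero_mul]
      · rw [coeff_eq_zero_of_natDegree_lt (p1.trans_lt hk), zero_mul]
    -- The bound says `r ≤ 0` at every natural number, but `r` has the positive leading coefficient
    -- `K`.
    set r : ℚ[X] := C K * X ^ D - q with hr
    have hrD : r.coeff D = K := by
      rw [hr, coeff_sub, hqc D le_rfl, coeff_C_mul_X_pow, if_pos rfl, sub_zero]
    have hrd : r.natDegree = D := by
      refine natDegree_eq_of_le_of_coeff_ne_zero (natDegree_le_iff_coeff_eq_zero.2 fun k hk => ?_)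
        (by rw [hrD]; exact hKpos.ne')
      rw [hr, coeff_sub, hqc k (le_of_lt hk), coeff_C_mul_X_pow, if_neg (by omega), sub_zero]
    have ht := Polynomial.tendsto_atTop_of_leadingCoeff_nonneg r
      (natDegree_pos_iff_degree_pos.1 (by omega))
      (by rw [leadingCoeff, hrd, hrD]; exact hKpos.le)
    obtain ⟨M, hM⟩ := ((ht.comp tendsto_natCast_atTop_atTop).eventually_gt_atTop 0).exists
    have hb := bound M
    rw [Function.comp_apply, hr, eval_sub, eval_mul, eval_C, eval_pow, eval_X, hq, eval_comp,
      eval_mul, eval_C, eval_X] at hM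
    linarith
  · have hF := HasLeading.sum Finset.univ fun σ _ => (hw σ).const_mul (Equiv.Perm.sign σ : ℚ)
    have : pointDetSum α = fun n => ∑ σ : Equiv.Perm (Fin α), (Equiv.Perm.sign σ : ℚ) *
        nestedSum (fun j n => parityBinom (σ j : Fin α) n) n := by
      funext n
      rw [← sum_increasing_det_eq_sum_perm (fun m n => parityBinom m n)]
      rfl
    rw [this]
    exact hF

end DegreeOfPointDetSum

/-! ### Vanishing with one more point than rows -/

section OneExtraPoint

lemma sum_increasing_self_succ {M : Type*} [AddCommMonoid M] (α : ℕ) (f : (Fin α → ℕ) → M) :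
    ∑ l ∈ increasing α (α + 1), f l = ∑ c : Fin (α + 1), f fun j => (c.succAbove j : ℕ) := by
  classical
  symm
  refine Finset.sum_bij (fun c _ j => (c.succAbove j : ℕ)) ?_ ?_ ?_ fun _ _ => rfl
  · intro c _
    exact mem_increasing.2 ⟨fun j => (c.succAbove j).2, fun i j hij => Fin.strictMono_succAbove c hij⟩
  · intro a _ b _ hab
    refine Fin.succAbove_left_injective (funext fun j => Fin.ext ?_)
    exact congrFun hab j
  · intro l hl
    obtain ⟨h1, h2⟩ := mem_increasing.1 hl
    let l' : Fin α → Fin (α + 1) := fun j => ⟨l j, h1 j⟩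
    have hl' : StrictMono l' := fun i j hij => h2 hij
    have hns : ¬ Function.Surjective l' := fun hs => by
      have := Fintype.card_le_of_surjective l' hs
      simp at this
    obtain ⟨c, hc⟩ := not_forall.1 hns
    refine ⟨c, Finset.mem_univ c, ?_⟩
    have hr : Set.range (c.succAbove) = Set.range l' := by
      have hsub : Finset.univ.image l' ⊆ Finset.univ.image c.succAbove := by
        intro x hx
        obtain ⟨j, _, rfl⟩ := Finset.mem_image.1 hx
        have : l' j ∈ Set.range c.succAbove := by
          rw [Fin.range_succAbove]
          exact fun h => hc ⟨j, h⟩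
        simpa using this
      have := Finset.eq_of_subset_of_card_le hsub (by
        rw [Finset.card_image_of_injective _ hl'.injective,
          Finset.card_image_of_injective _ (Fin.strictMono_succAbove c).injective])
      have := congrArg (fun s : Finset (Fin (α + 1)) => (s : Set (Fin (α + 1)))) this
      simpa using this.symm
    have := ((Fin.strictMono_succAbove c).range_inj hl').1 hr
    funext j
    rw [this]

/-- Rows `(u c, parityBinom · c)`. -/
def augmentedMatrix (α : ℕ) (u : ℕ → ℚ) : Matrix (Fin (α + 1)) (Fin (α + 1)) ℚ :=
  Matrix.of fun c => (Fin.cons (u c) fun m : Fin α => parityBinom m (c : ℕ) : Fin (α + 1) → ℚ)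

lemma det_augmentedMatrix (α : ℕ) (u : ℕ → ℚ) : (augmentedMatrix α u).det =
    ∑ c : Fin (α + 1), (-1) ^ (c : ℕ) * u c * pointDet fun j => (c.succAbove j : ℕ) := by
  rw [Matrix.det_succ_column_zero]
  refine Finset.sum_congr rfl fun c _ => ?_
  rfl

/-- Each tuple omits one point, so the sum is the expansion of a determinant along an added column
`(-1) ^ c`. Replacing that column by ones does not change the determinant. The sum of the two
columns is twice the column `parityBinom 0`, which is already present, so twice the determinant is
zero. -/
lemma pointDetSum_two_mul_succ (h : ℕ) (hh : 1 ≤ h) : pointDetSum (2 * h) (2 * h + 1) = 0 := by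
  have e1 : pointDetSum (2 * h) (2 * h + 1) = (augmentedMatrix (2 * h) fun c => (-1) ^ c).det := by
    rw [pointDetSum, sum_increasing_self_succ, det_augmentedMatrix]
    refine Finset.sum_congr rfl fun c _ => ?_
    rw [← mul_pow]
    simp
  have e2 : (augmentedMatrix (2 * h) fun c => (-1) ^ c).det =
      (augmentedMatrix (2 * h) fun _ => 1).det := by
    have r := Matrix.det_mul_column (fun c : Fin (2 * h + 1) => (-1 : ℚ) ^ (c : ℕ))
      (augmentedMatrix (2 * h) fun c => (-1) ^ c)
    have c := Matrix.det_mul_row (Fin.cons 1 fun m : Fin (2 * h) => (-1 : ℚ) ^ (m : ℕ))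
      (augmentedMatrix (2 * h) fun _ => 1)
    -- `parityBinom m c` is nonzero only for `c ≡ m` mod 2, so signs by rows can be traded for signs
    -- by columns.
    have hmat : (Matrix.of fun i j : Fin (2 * h + 1) => (-1 : ℚ) ^ (i : ℕ) *
        augmentedMatrix (2 * h) (fun c => (-1) ^ c) i j) =
        Matrix.of fun i j : Fin (2 * h + 1) => (Fin.cons 1 fun m : Fin (2 * h) =>
          (-1 : ℚ) ^ (m : ℕ) : Fin (2 * h + 1) → ℚ) j *
          augmentedMatrix (2 * h) (fun _ => 1) i j := by
      ext i j
      simp only [Matrix.of_apply, augmentedMatrix]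
      refine Fin.cases ?_ (fun m => ?_) j
      · simp only [Fin.cons_zero]
        rw [← mul_pow]
        simp
      · simp only [Fin.cons_succ]
        unfold parityBinom
        split_ifs with hp
        · have : Even ((i : ℕ) + (m : ℕ)) := by exact_mod_cast hp
          congr 1
          rcases Nat.even_or_odd (i : ℕ) with hi | hi
          · rw [hi.neg_one_pow, Even.neg_one_pow ((Nat.even_add.1 this).1 hi)]
          · rw [hi.neg_one_pow, Odd.neg_one_pow]
            rw [← Nat.not_even_iff_odd] at hi ⊢
            exact fun hm => hi ((Nat.even_add.1 this).2 hm)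
        · simp
    rw [hmat, c, Fin.prod_univ_succ, Fin.prod_univ_castSucc] at r
    simp only [Fin.cons_zero, Fin.cons_succ, one_mul, Fin.val_castSucc, Fin.val_last] at r
    -- The rows carry one sign more than the columns, `(-1) ^ (2 * h)`; it is trivial because `α = 2
    -- * h` is even.
    rw [(even_two_mul h).neg_one_pow, mul_one] at r
    have hne : (∏ m : Fin (2 * h), (-1 : ℚ) ^ (m : ℕ)) ≠ 0 :=
      Finset.prod_ne_zero_iff.2 fun m _ => pow_ne_zero _ (by norm_num)
    exact (mul_left_cancel₀ hne r).symm
  have e3 : (augmentedMatrix (2 * h) fun c => (-1) ^ c).det +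
      (augmentedMatrix (2 * h) fun _ => 1).det =
      2 * (augmentedMatrix (2 * h) fun c => parityBinom 0 (c : ℕ)).det := by
    rw [det_augmentedMatrix, det_augmentedMatrix, det_augmentedMatrix, Finset.mul_sum,
      ← Finset.sum_add_distrib]
    refine Finset.sum_congr rfl fun c _ => ?_
    rw [parityBinom_zero]
    rcases Nat.even_or_odd (c : ℕ) with hc | hc
    · rw [if_pos (by exact_mod_cast hc), hc.neg_one_pow]; ring
    · rw [if_neg (by simpa using hc), hc.neg_one_pow]; ring
  have e4 : (augmentedMatrix (2 * h) fun c => parityBinom 0 (c : ℕ)).det = 0 := by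
    refine Matrix.det_zero_of_column_eq (i := 0) (j := Fin.succ ⟨0, by omega⟩)
      (Fin.succ_ne_zero _).symm fun c => ?_
    simp only [augmentedMatrix, Matrix.of_apply, Fin.cons_zero, Fin.cons_succ]
  rw [e1]
  rw [e4, e2] at e3
  rw [e2]
  linarith

end OneExtraPoint

/-! ### Interlacing triangular arrays -/

section Arrays

/-- Triangular arrays: the rows `2 s + 1` and `2 s + 2` have `s + 1` entries, at the positions
`0, …, s`, consecutive rows interlace, and all other entries vanish. -/
structure IsArray (k : ℕ) (a : ℕ → ℕ → ℕ) : Prop where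
  zero : ∀ u j, 2 * k < u ∨ u ≤ 2 * j → a u j = 0
  le_even : ∀ s < k, ∀ j ≤ s, a (2 * s + 1) j ≤ a (2 * s + 2) j
  even_lt : ∀ s < k, ∀ j < s, a (2 * s + 2) j < a (2 * s + 1) (j + 1)
  odd_le : ∀ s < k, ∀ j < s, a (2 * s + 1) j ≤ a (2 * s) j
  lt_odd : ∀ s < k, ∀ j < s, a (2 * s) j < a (2 * s + 1) (j + 1)

/-- Put the rows `y` and `l` on top of the array `a`. -/
def extendArray {k : ℕ} (l y : Fin (k + 1) → ℕ) (a : ℕ → ℕ → ℕ) (u j : ℕ) : ℕ :=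
  if u = 2 * k + 2 then (if h : j < k + 1 then l ⟨j, h⟩ else 0)
  else if u = 2 * k + 1 then (if h : j < k + 1 then y ⟨j, h⟩ else 0) else a u j

lemma extendArray_even {k : ℕ} (l y : Fin (k + 1) → ℕ) (a : ℕ → ℕ → ℕ) {j : ℕ} (h : j < k + 1) :
    extendArray l y a (2 * k + 2) j = l ⟨j, h⟩ := by
  simp [extendArray, h]

lemma extendArray_odd {k : ℕ} (l y : Fin (k + 1) → ℕ) (a : ℕ → ℕ → ℕ) {j : ℕ} (h : j < k + 1) :
    extendArray l y a (2 * k + 1) j = y ⟨j, h⟩ := by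
  simp [extendArray, h]

lemma extendArray_of_le {k : ℕ} (l y : Fin (k + 1) → ℕ) (a : ℕ → ℕ → ℕ) {u : ℕ} (h : u ≤ 2 * k) :
    extendArray l y a u = a u := by
  funext j
  rw [extendArray, if_neg (by omega), if_neg (by omega)]

/-- The arrays with `k` pairs of rows and top row `l`. -/
noncomputable def arraysWithTop : (k : ℕ) → (Fin k → ℕ) → Finset (ℕ → ℕ → ℕ)
  | 0, _ => {fun _ _ => 0}
  | k + 1, l => by
    classical
    exact ((oddRows l).sigma fun y => (evenRows y).sigma fun x => arraysWithTop k x).image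
      fun q => extendArray l q.1 q.2.2

lemma mem_oddRows {k : ℕ} {l y : Fin (k + 1) → ℕ} : y ∈ oddRows l ↔
    (∀ j, y j ≤ l j) ∧ ∀ j : Fin k, l j.castSucc < y j.succ := by
  rw [oddRows, Fintype.mem_piFinset, Fin.forall_fin_succ, Fin.forall_fin_succ (P := fun j => y j ≤ l j)]
  simp only [Fin.cons_zero, Fin.cons_succ, Finset.mem_Ico, Nat.lt_succ_iff, Nat.succ_le_iff,
    Nat.zero_le, true_and, forall_and]
  tauto

lemma mem_evenRows {k : ℕ} {y : Fin (k + 1) → ℕ} {x : Fin k → ℕ} : x ∈ evenRows y ↔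
    ∀ j, y j.castSucc ≤ x j ∧ x j < y j.succ := by
  simp [evenRows, Fintype.mem_piFinset]

lemma mem_arraysWithTop : ∀ {k : ℕ} {l : Fin k → ℕ} {a : ℕ → ℕ → ℕ},
    a ∈ arraysWithTop k l ↔ IsArray k a ∧ ∀ j : Fin k, a (2 * k) j = l j := by
  classical
  intro k
  induction k with
  | zero =>
    intro l a
    rw [arraysWithTop, Finset.mem_singleton]
    constructor
    · rintro rfl
      exact ⟨⟨fun _ _ _ => rfl, by simp, by simp, by simp, by simp⟩, fun j => j.elim0⟩
    · rintro ⟨h, -⟩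
      funext u j
      exact h.zero u j (by omega)
  | succ k ih =>
    intro l a
    rw [arraysWithTop, Finset.mem_image]
    constructor
    · rintro ⟨⟨y, x, a'⟩, hq, rfl⟩
      rw [Finset.mem_sigma, Finset.mem_sigma] at hq
      obtain ⟨hy, hx, ha⟩ := hq
      obtain ⟨ha, hax⟩ := ih.1 ha
      obtain ⟨hy1, hy2⟩ := mem_oddRows.1 hy
      have hx := mem_evenRows.1 hx
      dsimp only at hx ha hax hy1 hy2 ⊢
      refine ⟨⟨?_, ?_, ?_, ?_, ?_⟩, fun j => ?_⟩
      · intro u j h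
        dsimp only [extendArray]
        split_ifs with h1 h2 h3 h4
        · omega
        · rfl
        · omega
        · rfl
        · exact ha.zero u j (by omega)
      · intro s hs j hj
        rcases Nat.lt_succ_iff_lt_or_eq.1 hs with h | rfl
        · rw [extendArray_of_le _ _ _ (by omega), extendArray_of_le _ _ _ (by omega)]
          exact ha.le_even s h j hj
        · rw [extendArray_odd _ _ _ (by omega), extendArray_even _ _ _ (by omega)]
          exact hy1 _
      · intro s hs j hj
        rcases Nat.lt_succ_iff_lt_or_eq.1 hs with h | rfl
        · rw [extendArray_of_le _ _ _ (by omega), extendArray_of_le _ _ _ (by omega)]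
          exact ha.even_lt s h j hj
        · rw [extendArray_odd _ _ _ (by omega), extendArray_even _ _ _ (by omega)]
          exact hy2 ⟨j, hj⟩
      · intro s hs j hj
        rcases Nat.lt_succ_iff_lt_or_eq.1 hs with h | rfl
        · rw [extendArray_of_le _ _ _ (by omega), extendArray_of_le _ _ _ (by omega)]
          exact ha.odd_le s h j hj
        · rw [extendArray_odd _ _ _ (by omega), extendArray_of_le _ _ _ (by omega),
            hax ⟨j, hj⟩]
          exact (hx ⟨j, hj⟩).1
      · intro s hs j hj
        rcases Nat.lt_succ_iff_lt_or_eq.1 hs with h | rfl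
        · rw [extendArray_of_le _ _ _ (by omega), extendArray_of_le _ _ _ (by omega)]
          exact ha.lt_odd s h j hj
        · rw [extendArray_odd _ _ _ (by omega), extendArray_of_le _ _ _ (by omega),
            hax ⟨j, hj⟩]
          exact (hx ⟨j, hj⟩).2
      · exact extendArray_even _ _ _ j.2
    · rintro ⟨ha, hl⟩
      refine ⟨⟨fun j => a (2 * k + 1) j, fun j => a (2 * k) j,
        fun u j => if u ≤ 2 * k then a u j else 0⟩, ?_, ?_⟩
      · rw [Finset.mem_sigma, Finset.mem_sigma]
        refine ⟨mem_oddRows.2 ⟨fun j => ?_, fun j => ?_⟩, mem_evenRows.2 fun j => ⟨?_, ?_⟩,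
          ih.2 ⟨⟨?_, ?_, ?_, ?_, ?_⟩, fun j => ?_⟩⟩
        · rw [← hl]
          exact ha.le_even k (by omega) j (by omega)
        · rw [← hl]
          exact ha.even_lt k (by omega) j (by simp)
        · exact ha.odd_le k (by omega) j (by simp)
        · exact ha.lt_odd k (by omega) j (by simp)
        · intro u j h
          dsimp only
          split_ifs with h1
          · exact ha.zero u j (by omega)
          · rfl
        · intro s hs j hj
          dsimp only
          rw [if_pos (by omega), if_pos (by omega)]
          exact ha.le_even s (by omega) j hj
        · intro s hs j hj
          dsimp only
          rw [if_pos (by omega), if_pos (by omega)]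
          exact ha.even_lt s (by omega) j hj
        · intro s hs j hj
          dsimp only
          rw [if_pos (by omega), if_pos (by omega)]
          exact ha.odd_le s (by omega) j hj
        · intro s hs j hj
          dsimp only
          rw [if_pos (by omega), if_pos (by omega)]
          exact ha.lt_odd s (by omega) j hj
        · simp
      · funext u j
        dsimp only [extendArray]
        split_ifs with h1 h2 h3 h4 h5
        · rw [← hl, h1]; rfl
        · exact (ha.zero u j (by omega)).symm
        · rw [h3]
        · exact (ha.zero u j (by omega)).symm
        · rfl
        · exact (ha.zero u j (by omega)).symm

/-- The sum of the entries of an array. -/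
def arrayWeight (k : ℕ) (a : ℕ → ℕ → ℕ) : ℕ :=
  ∑ u ∈ Finset.range (2 * k + 1), ∑ j ∈ Finset.range ((u + 1) / 2), a u j

lemma arrayWeight_extendArray {k : ℕ} (l y : Fin (k + 1) → ℕ) (a : ℕ → ℕ → ℕ) :
    arrayWeight (k + 1) (extendArray l y a) = ∑ j, l j + ∑ j, y j + arrayWeight k a := by
  rw [arrayWeight, show 2 * (k + 1) + 1 = 2 * k + 1 + 1 + 1 by ring, Finset.sum_range_succ,
    Finset.sum_range_succ, show (2 * k + 1 + 1) / 2 = k + 1 by omega,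
    show (2 * k + 1 + 1 + 1) / 2 = k + 1 by omega,
    Finset.sum_range (extendArray l y a (2 * k + 1)),
    Finset.sum_range (extendArray l y a (2 * k + 1 + 1)), arrayWeight]
  have e : ∑ u ∈ Finset.range (2 * k + 1), ∑ j ∈ Finset.range ((u + 1) / 2), extendArray l y a u j =
      ∑ u ∈ Finset.range (2 * k + 1), ∑ j ∈ Finset.range ((u + 1) / 2), a u j := by
    refine Finset.sum_congr rfl fun u hu => ?_
    rw [extendArray_of_le _ _ _ (Nat.lt_succ_iff.1 (Finset.mem_range.1 hu))]
  rw [e, Finset.sum_congr rfl fun j _ => extendArray_odd l y a (j := (j : Fin (k + 1))) j.2,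
    Finset.sum_congr rfl fun j _ => extendArray_even l y a (j := (j : Fin (k + 1))) j.2]
  ring

/-- The signed count of the arrays with a given top row is a determinant. -/
theorem sum_arraysWithTop : ∀ {k : ℕ} (l : Fin k → ℕ), StrictMono l →
    ∑ a ∈ arraysWithTop k l, (-1 : ℚ) ^ arrayWeight k a = pointDet fun j => (l j : ℤ) := by
  classical
  intro k
  induction k with
  | zero => intro l _; simp [arraysWithTop, arrayWeight, pointDet]
  | succ k ih =>
    intro l hl
    rw [arraysWithTop, Finset.sum_image, Finset.sum_sigma, ← sum_oddRows_sum_evenRows l hl]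
    · refine Finset.sum_congr rfl fun y _ => ?_
      rw [Finset.sum_sigma]
      refine Finset.sum_congr rfl fun x hx => ?_
      have hx' : StrictMono x := by
        have := mem_evenRows.1 hx
        cases k with
        | zero => exact fun i => i.elim0
        | succ k =>
          refine Fin.strictMono_iff_lt_succ.2 fun i => ?_
          have h1 := (this i.castSucc).2
          have h2 := (this i.succ).1
          rw [← Fin.succ_castSucc] at h2
          omega
      rw [← ih x hx', Finset.mul_sum]
      refine Finset.sum_congr rfl fun a _ => ?_
      rw [arrayWeight_extendArray, pow_add]
    · rintro ⟨y, x, a⟩ h ⟨y', x', a'⟩ h' he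
      rw [Finset.mem_coe, Finset.mem_sigma, Finset.mem_sigma] at h h'
      obtain ⟨ha, hx⟩ := mem_arraysWithTop.1 h.2.2
      obtain ⟨ha', hx'⟩ := mem_arraysWithTop.1 h'.2.2
      dsimp only at ha hx ha' hx' he
      have hyy : y = y' := by
        funext j
        have := congrFun (congrFun he (2 * k + 1)) j
        rwa [extendArray_odd _ _ _ j.2, extendArray_odd _ _ _ j.2] at this
      have haa : a = a' := by
        funext u j
        by_cases hu : u ≤ 2 * k
        · have := congrFun (congrFun he u) j
          rwa [extendArray_of_le _ _ _ hu, extendArray_of_le _ _ _ hu] at this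
        · rw [ha.zero u j (by omega), ha'.zero u j (by omega)]
      have hxx : x = x' := by
        funext j
        rw [← hx, ← hx', haa]
      subst hyy haa hxx
      rfl

end Arrays

/-! ### Quarter heights as arrays -/

section QuarterHeights

/-- Heights over the quarter `i ≤ j`, `i + j ≤ 2 α + 1` of the square: shifted trapezoidal plane
partitions with parts at most `b`. -/
structure IsQuarter (α b : ℕ) (γ : ℕ → ℕ → ℕ) : Prop where
  zero : ∀ i j, i = 0 ∨ j < i ∨ 2 * α + 1 < i + j → γ i j = 0
  succ_right : ∀ i j, 1 ≤ i → i ≤ j → γ i (j + 1) ≤ γ i j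
  succ_left : ∀ i j, 1 ≤ i → i + 1 ≤ j → γ (i + 1) j ≤ γ i j
  le : γ 1 1 ≤ b

lemma IsQuarter.antitone {α b : ℕ} {γ : ℕ → ℕ → ℕ} (h : IsQuarter α b γ) {i j i' j' : ℕ}
    (hi : 1 ≤ i) (hij : i ≤ j) (hii : i ≤ i') (hjj : j ≤ j') (hij' : i' ≤ j') :
    γ i' j' ≤ γ i j := by
  have h1 : ∀ d, γ i (j + d) ≤ γ i j := by
    intro d
    induction d with
    | zero => exact le_rfl
    | succ d ih => exact (h.succ_right i (j + d) hi (by omega)).trans ih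
  have h2 : ∀ d, i + d ≤ j' → γ (i + d) j' ≤ γ i j' := by
    intro d
    induction d with
    | zero => exact fun _ => le_rfl
    | succ d ih =>
      exact fun hd => (h.succ_left (i + d) j' (by omega) (by omega)).trans (ih (by omega))
  have e1 := h1 (j' - j)
  have e2 := h2 (i' - i) (by omega)
  rw [Nat.add_sub_cancel' hjj] at e1
  rw [Nat.add_sub_cancel' hii] at e2
  exact e2.trans e1

lemma IsQuarter.le_height {α b : ℕ} {γ : ℕ → ℕ → ℕ} (h : IsQuarter α b γ) (i j : ℕ) :
    γ i j ≤ b := by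
  by_cases hz : i = 0 ∨ j < i ∨ 2 * α + 1 < i + j
  · rw [h.zero i j hz]; exact Nat.zero_le b
  · exact (h.antitone le_rfl le_rfl (by omega) (by omega) (by omega)).trans h.le

/-- The array of the quarter heights, along the diagonals, starting from the shortest. -/
def quarterToArray (α : ℕ) (γ : ℕ → ℕ → ℕ) (u j : ℕ) : ℕ :=
  if 2 * j < u ∧ u ≤ 2 * α then γ ((u + 1) / 2 - j) (2 * α + ((u + 1) / 2 - j) - u) + j else 0

/-- The quarter heights of an array. -/
def arrayToQuarter (α : ℕ) (a : ℕ → ℕ → ℕ) (i j : ℕ) : ℕ :=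
  if 1 ≤ i ∧ i ≤ j ∧ i + j ≤ 2 * α + 1 then
    a (2 * α + i - j) ((2 * α + 1 - i - j) / 2) - (2 * α + 1 - i - j) / 2 else 0

lemma arrayToQuarter_quarterToArray {α b : ℕ} {γ : ℕ → ℕ → ℕ} (h : IsQuarter α b γ) :
    arrayToQuarter α (quarterToArray α γ) = γ := by
  funext i j
  unfold arrayToQuarter
  split_ifs with hr
  · rw [quarterToArray, if_pos (by omega), Nat.add_sub_cancel]
    congr 1 <;> omega
  · exact (h.zero i j (by omega)).symm

/-- Two rows combine to strict increase along a row. Hence the subtraction in `arrayToQuarter` does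
not truncate. -/
lemma IsArray.le_entry {k : ℕ} {a : ℕ → ℕ → ℕ} (h : IsArray k a) : ∀ j s, s < k → j ≤ s →
    j ≤ a (2 * s + 1) j ∧ j ≤ a (2 * s + 2) j := by
  intro j
  induction j with
  | zero => exact fun s _ _ => ⟨Nat.zero_le _, Nat.zero_le _⟩
  | succ j ih =>
    intro s hs hj
    have h1 := (ih s hs (by omega)).2
    have h2 := h.even_lt s hs j (by omega)
    have h3 := h.le_even s hs (j + 1) hj
    omega

lemma quarterToArray_arrayToQuarter {α : ℕ} {a : ℕ → ℕ → ℕ} (h : IsArray α a) :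
    quarterToArray α (arrayToQuarter α a) = a := by
  funext u j
  unfold quarterToArray
  split_ifs with hr
  · rw [arrayToQuarter, if_pos (by omega)]
    have e1 : 2 * α + ((u + 1) / 2 - j) - (2 * α + ((u + 1) / 2 - j) - u) = u := by omega
    have e2 : (2 * α + 1 - ((u + 1) / 2 - j) - (2 * α + ((u + 1) / 2 - j) - u)) / 2 = j := by omega
    rw [e1, e2]
    refine Nat.sub_add_cancel ?_
    rcases Nat.even_or_odd' u with ⟨s, hs | hs⟩
    · obtain ⟨s, rfl⟩ : ∃ t, s = t + 1 := ⟨s - 1, by omega⟩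
      rw [hs]
      exact (h.le_entry j s (by omega) (by omega)).2
    · rw [hs]
      exact (h.le_entry j s (by omega) (by omega)).1
  · exact (h.zero u j (by omega)).symm

/-- Row `u` is the diagonal with column minus row index `2α - u`. Neighbouring cells lie in
consecutive rows; where the position increases by one, the added position makes the weak inequality
strict. -/
lemma IsQuarter.isArray {α b : ℕ} {γ : ℕ → ℕ → ℕ} (h : IsQuarter α b γ) :
    IsArray α (quarterToArray α γ) := by
  refine ⟨fun u j hu => if_neg (by omega), fun s hs j hj => ?_, fun s hs j hj => ?_,
    fun s hs j hj => ?_, fun s hs j hj => ?_⟩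
  · rw [quarterToArray, quarterToArray, if_pos (by omega), if_pos (by omega)]
    have := h.succ_right (s + 1 - j) (2 * α + (s + 1 - j) - (2 * s + 2)) (by omega) (by omega)
    rw [show (2 * s + 1 + 1) / 2 = s + 1 by omega, show (2 * s + 2 + 1) / 2 = s + 1 by omega,
      show 2 * α + (s + 1 - j) - (2 * s + 1) = 2 * α + (s + 1 - j) - (2 * s + 2) + 1 by omega]
    omega
  · rw [quarterToArray, quarterToArray, if_pos (by omega), if_pos (by omega)]
    have := h.succ_left (s - j) (2 * α + (s + 1 - j) - (2 * s + 2)) (by omega) (by omega)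
    rw [show (2 * s + 1 + 1) / 2 - (j + 1) = s - j by omega,
      show (2 * s + 2 + 1) / 2 - j = s - j + 1 by omega,
      show 2 * α + (s - j) - (2 * s + 1) = 2 * α + (s + 1 - j) - (2 * s + 2) by omega,
      show 2 * α + (s - j + 1) - (2 * s + 2) = 2 * α + (s + 1 - j) - (2 * s + 2) by omega]
    omega
  · rw [quarterToArray, quarterToArray, if_pos (by omega), if_pos (by omega)]
    have := h.succ_left (s - j) (2 * α + (s - j) - 2 * s) (by omega) (by omega)
    rw [show (2 * s + 1) / 2 - j = s - j by omega,
      show (2 * s + 1 + 1) / 2 - j = s - j + 1 by omega,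
      show 2 * α + (s - j + 1) - (2 * s + 1) = 2 * α + (s - j) - 2 * s by omega]
    omega
  · rw [quarterToArray, quarterToArray, if_pos (by omega), if_pos (by omega)]
    have := h.succ_right (s - j) (2 * α + (s - j) - (2 * s + 1)) (by omega) (by omega)
    rw [show (2 * s + 1) / 2 - j = s - j by omega,
      show (2 * s + 1 + 1) / 2 - (j + 1) = s - j by omega,
      show 2 * α + (s - j) - 2 * s = 2 * α + (s - j) - (2 * s + 1) + 1 by omega]
    omega

lemma IsQuarter.top_lt {α b : ℕ} {γ : ℕ → ℕ → ℕ} (h : IsQuarter α b γ) (j : ℕ) (hj : j < α) :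
    quarterToArray α γ (2 * α) j < b + α := by
  rw [quarterToArray, if_pos (by omega)]
  have := h.le_height ((2 * α + 1) / 2 - j) (2 * α + ((2 * α + 1) / 2 - j) - 2 * α)
  omega

lemma IsArray.isQuarter {α b : ℕ} (hα : 1 ≤ α) {a : ℕ → ℕ → ℕ} (h : IsArray α a)
    (ht : ∀ j < α, a (2 * α) j < b + α) : IsQuarter α b (arrayToQuarter α a) := by
  refine ⟨fun i j hij => if_neg (by omega), fun i j hi hij => ?_, fun i j hi hij => ?_, ?_⟩
  · by_cases hr : i + (j + 1) ≤ 2 * α + 1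
    · rw [arrayToQuarter, arrayToQuarter, if_pos (by omega), if_pos (by omega)]
      rcases Nat.even_or_odd' (2 * α + i - j) with ⟨s, hs | hs⟩
      · obtain ⟨s, rfl⟩ : ∃ t, s = t + 1 := ⟨s - 1, by omega⟩
        have := h.le_even s (by omega) ((2 * α + 1 - i - j) / 2) (by omega)
        rw [show 2 * α + i - (j + 1) = 2 * s + 1 by omega, show 2 * α + i - j = 2 * s + 2 by omega,
          show (2 * α + 1 - i - (j + 1)) / 2 = (2 * α + 1 - i - j) / 2 by omega]
        omega
      · have := h.lt_odd s (by omega) ((2 * α + 1 - i - (j + 1)) / 2) (by omega)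
        rw [show 2 * α + i - (j + 1) = 2 * s by omega, hs,
          show (2 * α + 1 - i - j) / 2 = (2 * α + 1 - i - (j + 1)) / 2 + 1 by omega]
        omega
    · rw [arrayToQuarter, if_neg (by omega)]
      exact Nat.zero_le _
  · by_cases hr : i + 1 + j ≤ 2 * α + 1
    · rw [arrayToQuarter, arrayToQuarter, if_pos (by omega), if_pos (by omega)]
      rcases Nat.even_or_odd' (2 * α + i - j) with ⟨s, hs | hs⟩
      · have := h.odd_le s (by omega) ((2 * α + 1 - i - j) / 2) (by omega)
        rw [show 2 * α + (i + 1) - j = 2 * s + 1 by omega, hs,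
          show (2 * α + 1 - (i + 1) - j) / 2 = (2 * α + 1 - i - j) / 2 by omega]
        omega
      · have := h.even_lt s (by omega) ((2 * α + 1 - (i + 1) - j) / 2) (by omega)
        rw [show 2 * α + (i + 1) - j = 2 * s + 2 by omega, hs,
          show (2 * α + 1 - i - j) / 2 = (2 * α + 1 - (i + 1) - j) / 2 + 1 by omega]
        omega
    · rw [arrayToQuarter, if_neg (by omega)]
      exact Nat.zero_le _
  · rw [arrayToQuarter, if_pos (by omega), Nat.add_sub_cancel,
      show (2 * α - 1) / 2 = α - 1 by omega]
    have := ht (α - 1) (by omega)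
    omega

/-- The total height of the quarter. -/
def quarterSum (α : ℕ) (γ : ℕ → ℕ → ℕ) : ℕ :=
  ∑ q ∈ (Finset.Icc 1 (2 * α + 1) ×ˢ Finset.Icc 1 (2 * α + 1)).filter
    (fun q => q.1 ≤ q.2 ∧ q.1 + q.2 ≤ 2 * α + 1), γ q.1 q.2

/-- The added positions do not affect the sign: rows `2s + 1` and `2s + 2` have the same length, so
their shifts add up to an even number. -/
lemma neg_one_pow_arrayWeight (α : ℕ) (γ : ℕ → ℕ → ℕ) :
    (-1 : ℚ) ^ arrayWeight α (quarterToArray α γ) = (-1) ^ quarterSum α γ := by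
  have hpos : ∀ n : ℕ, Even (∑ u ∈ Finset.range (2 * n + 1), ∑ j ∈ Finset.range ((u + 1) / 2), j) := by
    intro n
    induction n with
    | zero => simp
    | succ n ih =>
      rw [show 2 * (n + 1) + 1 = 2 * n + 1 + 1 + 1 by ring, Finset.sum_range_succ,
        Finset.sum_range_succ, show (2 * n + 1 + 1) / 2 = n + 1 by omega,
        show (2 * n + 1 + 1 + 1) / 2 = n + 1 by omega, add_assoc]
      exact ih.add ⟨_, rfl⟩
  have hw : arrayWeight α (quarterToArray α γ) = quarterSum α γ +
      ∑ u ∈ Finset.range (2 * α + 1), ∑ j ∈ Finset.range ((u + 1) / 2), j := by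
    have e : arrayWeight α (quarterToArray α γ) =
        ∑ u ∈ Finset.range (2 * α + 1), ∑ j ∈ Finset.range ((u + 1) / 2),
          (γ ((u + 1) / 2 - j) (2 * α + ((u + 1) / 2 - j) - u) + j) := by
      refine Finset.sum_congr rfl fun u hu => Finset.sum_congr rfl fun j hj => ?_
      rw [Finset.mem_range] at hu hj
      rw [quarterToArray, if_pos (by omega)]
    rw [e]
    simp only [Finset.sum_add_distrib]
    congr 1
    rw [Finset.sum_sigma', quarterSum]
    refine Finset.sum_nbij' (fun q => ((q.1 + 1) / 2 - q.2, 2 * α + ((q.1 + 1) / 2 - q.2) - q.1))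
      (fun q => ⟨2 * α + q.1 - q.2, (2 * α + 1 - q.1 - q.2) / 2⟩) ?_ ?_ ?_ ?_ ?_
    · rintro ⟨u, j⟩ h
      simp only [Finset.mem_sigma, Finset.mem_range] at h
      simp only [Finset.mem_filter, Finset.mem_product, Finset.mem_Icc]
      omega
    · rintro ⟨i, j⟩ h
      simp only [Finset.mem_filter, Finset.mem_product, Finset.mem_Icc] at h
      simp only [Finset.mem_sigma, Finset.mem_range]
      omega
    · rintro ⟨u, j⟩ h
      simp only [Finset.mem_sigma, Finset.mem_range] at h
      have e1 : 2 * α + ((u + 1) / 2 - j) - (2 * α + ((u + 1) / 2 - j) - u) = u := by omega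
      have e2 : (2 * α + 1 - ((u + 1) / 2 - j) - (2 * α + ((u + 1) / 2 - j) - u)) / 2 = j := by
        omega
      simp only [e1, e2]
    · rintro ⟨i, j⟩ h
      simp only [Finset.mem_filter, Finset.mem_product, Finset.mem_Icc] at h
      ext <;> dsimp only <;> omega
    · rintro ⟨u, j⟩ _
      rfl
  rw [hw, pow_add, (hpos α).neg_one_pow, mul_one]

end QuarterHeights

/-! ### Plane partitions and their quarters -/

section PlanePartitions

/-- The height over `(x, y)`, `x ≤ y`, of the plane partition with quarter heights `γ`. -/
def quarterHeight (α b : ℕ) (γ : ℕ → ℕ → ℕ) (x y : ℕ) : ℕ :=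
  if x + y ≤ 2 * α + 2 then b + γ x y else b - γ (2 * α + 2 - y) (2 * α + 2 - x)

/-- The plane partition with quarter heights `γ`. -/
def quarterToPP (α b : ℕ) (γ : ℕ → ℕ → ℕ) : Finset (ℕ × ℕ × ℕ) :=
  (planePartitionBox (2 * α + 1) (2 * α + 1) (2 * b)).filter fun q =>
    q.2.2 ≤ quarterHeight α b γ (min q.1 q.2.1) (max q.1 q.2.1)

/-- The quarter heights of a plane partition. -/
def ppToQuarter (α b : ℕ) (P : Finset (ℕ × ℕ × ℕ)) (i j : ℕ) : ℕ :=
  if 1 ≤ i ∧ i ≤ j ∧ i + j ≤ 2 * α + 1 then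
    ((Finset.Icc 1 b).filter fun k => (i, j, b + k) ∈ P).card else 0

lemma le_card_filter_Icc_iff {b : ℕ} {p : ℕ → Prop} [DecidablePred p]
    (hp : ∀ k k', 1 ≤ k' → k' ≤ k → k ≤ b → p k → p k') {k : ℕ} (hk : 1 ≤ k) (hkb : k ≤ b) :
    k ≤ ((Finset.Icc 1 b).filter p).card ↔ p k := by
  constructor
  · intro h
    by_contra hn
    have hsub : (Finset.Icc 1 b).filter p ⊆ Finset.Icc 1 (k - 1) := by
      intro x hx
      simp only [Finset.mem_filter, Finset.mem_Icc] at hx ⊢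
      refine ⟨hx.1.1, ?_⟩
      by_contra hxk
      exact hn (hp x k hk (by omega) hx.1.2 hx.2)
    have := Finset.card_le_card hsub
    rw [Nat.card_Icc] at this
    omega
  · intro h
    have hsub : Finset.Icc 1 k ⊆ (Finset.Icc 1 b).filter p := by
      intro x hx
      simp only [Finset.mem_filter, Finset.mem_Icc] at hx ⊢
      exact ⟨⟨hx.1, hx.2.trans hkb⟩, hp k x hx.1 hx.2 hkb h⟩
    have := Finset.card_le_card hsub
    rwa [Nat.card_Icc, Nat.add_sub_cancel] at this

lemma mem_symmetricTCPP {a c : ℕ} {P : Finset (ℕ × ℕ × ℕ)} : P ∈ symmetricTCPP a c ↔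
    P ⊆ planePartitionBox a a c ∧
      IsPlanePartition P ∧ IsSymmetricPP P ∧ IsTransposeComplementaryPP a c P := by
  simp [symmetricTCPP]

lemma mem_planePartitionBox {a b c i j k : ℕ} : (i, j, k) ∈ planePartitionBox a b c ↔
    (1 ≤ i ∧ i ≤ a) ∧ (1 ≤ j ∧ j ≤ b) ∧ 1 ≤ k ∧ k ≤ c := by
  simp [planePartitionBox]

lemma mem_quarterToPP {α b : ℕ} {γ : ℕ → ℕ → ℕ} {i j k : ℕ} : (i, j, k) ∈ quarterToPP α b γ ↔
    ((1 ≤ i ∧ i ≤ 2 * α + 1) ∧ (1 ≤ j ∧ j ≤ 2 * α + 1) ∧ 1 ≤ k ∧ k ≤ 2 * b) ∧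
      k ≤ quarterHeight α b γ (min i j) (max i j) := by
  rw [quarterToPP, Finset.mem_filter, mem_planePartitionBox]

section FromQuarter

variable {α b : ℕ} {γ : ℕ → ℕ → ℕ}

lemma IsQuarter.quarterHeight_antitone (h : IsQuarter α b γ) {x y x' y' : ℕ} (hx' : 1 ≤ x')
    (hx : x' ≤ x) (hy : y' ≤ y) (hxy' : x' ≤ y') (hxy : x ≤ y) (hy1 : y ≤ 2 * α + 1) :
    quarterHeight α b γ x y ≤ quarterHeight α b γ x' y' := by
  unfold quarterHeight
  split_ifs with h1 h2 h3
  · exact Nat.add_le_add_left (h.antitone hx' hxy' hx hy hxy) b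
  · omega
  · omega
  · exact Nat.sub_le_sub_left (h.antitone (by omega) (by omega) (by omega) (by omega) (by omega)) b

/-- Reflection in the antidiagonal exchanges `b + γ` and `b - γ`; on the antidiagonal itself `γ` is
zero by default. -/
lemma IsQuarter.quarterHeight_add (h : IsQuarter α b γ) {x y : ℕ} (hx : 1 ≤ x) (hxy : x ≤ y)
    (hy : y ≤ 2 * α + 1) :
    quarterHeight α b γ x y + quarterHeight α b γ (2 * α + 2 - y) (2 * α + 2 - x) = 2 * b := by
  have hle := h.le_height
  unfold quarterHeight
  rcases lt_trichotomy (x + y) (2 * α + 2) with hlt | heq | hgt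
  · rw [if_pos hlt.le, if_neg (by omega), show 2 * α + 2 - (2 * α + 2 - x) = x by omega,
      show 2 * α + 2 - (2 * α + 2 - y) = y by omega]
    have := hle x y
    omega
  · rw [if_pos heq.le, if_pos (by omega), h.zero _ _ (by omega), h.zero _ _ (by omega)]
    omega
  · rw [if_neg (by omega), if_pos (by omega)]
    have := hle (2 * α + 2 - y) (2 * α + 2 - x)
    omega

lemma IsQuarter.quarterToPP_mem (h : IsQuarter α b γ) :
    quarterToPP α b γ ∈ symmetricTCPP (2 * α + 1) (2 * b) := by
  refine mem_symmetricTCPP.2 ⟨Finset.filter_subset _ _, ⟨fun i j k hP => ?_, ?_⟩, ?_, ?_⟩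
  · have := (mem_quarterToPP.1 hP).1
    omega
  · intro i j k i' j' k' hP hi' hii hj' hjj hk' hkk
    obtain ⟨hb, hk⟩ := mem_quarterToPP.1 hP
    refine mem_quarterToPP.2 ⟨by omega, hkk.trans (hk.trans ?_)⟩
    exact h.quarterHeight_antitone (by omega) (by omega) (by omega) (by omega) (by omega) (by omega)
  · intro i j k hP
    obtain ⟨hb, hk⟩ := mem_quarterToPP.1 hP
    refine mem_quarterToPP.2 ⟨by omega, ?_⟩
    rwa [min_comm, max_comm]
  · intro i j k hi hi' hj hj' hk hk'
    have hadd := h.quarterHeight_add (x := min i j) (y := max i j) (by omega) (by omega) (by omega)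
    have e1 : min (2 * α + 1 + 1 - j) (2 * α + 1 + 1 - i) = 2 * α + 2 - max i j := by omega
    have e2 : max (2 * α + 1 + 1 - j) (2 * α + 1 + 1 - i) = 2 * α + 2 - min i j := by omega
    rw [mem_quarterToPP, mem_quarterToPP, e1, e2]
    omega

lemma IsQuarter.ppToQuarter_quarterToPP (h : IsQuarter α b γ) :
    ppToQuarter α b (quarterToPP α b γ) = γ := by
  funext i j
  unfold ppToQuarter
  split_ifs with hr
  · have hle := h.le_height i j
    have : ((Finset.Icc 1 b).filter fun k => (i, j, b + k) ∈ quarterToPP α b γ) =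
        Finset.Icc 1 (γ i j) := by
      ext k
      rw [Finset.mem_filter, mem_quarterToPP, Finset.mem_Icc, Finset.mem_Icc, min_eq_left hr.2.1,
        max_eq_right hr.2.1, quarterHeight, if_pos (by omega)]
      omega
    rw [this, Nat.card_Icc, Nat.add_sub_cancel]
  · exact (h.zero i j (by omega)).symm

/-- On and beyond the antidiagonal the heights are at most `b`, so the counted cubes stand over the
quarter. -/
lemma IsQuarter.upperRightCount_quarterToPP (h : IsQuarter α b γ) :
    upperRightCount b (quarterToPP α b γ) = quarterSum α γ := by
  have hs : quarterSum α γ = ((((Finset.Icc 1 (2 * α + 1) ×ˢ Finset.Icc 1 (2 * α + 1)).filter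
      (fun q => q.1 ≤ q.2 ∧ q.1 + q.2 ≤ 2 * α + 1)).sigma
      fun q => Finset.Icc 1 (γ q.1 q.2))).card := by
    rw [Finset.card_sigma, quarterSum]
    simp
  rw [hs, upperRightCount]
  refine Finset.card_nbij' (fun q => ⟨(q.1, q.2.1), q.2.2 - b⟩)
    (fun q => (q.1.1, q.1.2, b + q.2)) ?_ ?_ ?_ ?_
  · rintro ⟨i, j, k⟩ hq
    simp only [Finset.coe_filter, Set.mem_ofPred_eq, mem_quarterToPP] at hq
    obtain ⟨⟨hb, hk⟩, hkb, hij⟩ := hq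
    rw [min_eq_left hij, max_eq_right hij, quarterHeight] at hk
    simp only [Finset.coe_sigma, Set.mem_sigma_iff, Finset.mem_coe, Finset.mem_filter,
      Finset.mem_product, Finset.mem_Icc]
    split_ifs at hk with hc
    · have : i + j ≤ 2 * α + 1 := by
        by_contra hn
        rw [h.zero i j (by omega)] at hk
        omega
      omega
    · omega
  · rintro ⟨⟨i, j⟩, k⟩ hq
    simp only [Finset.coe_sigma, Set.mem_sigma_iff, Finset.mem_coe, Finset.mem_filter,
      Finset.mem_product, Finset.mem_Icc] at hq
    simp only [Finset.coe_filter, Set.mem_ofPred_eq, mem_quarterToPP]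
    rw [min_eq_left hq.1.2.1, max_eq_right hq.1.2.1, quarterHeight, if_pos (by omega)]
    have := h.le_height i j
    omega
  · rintro ⟨i, j, k⟩ hq
    simp only [Finset.coe_filter, Set.mem_ofPred_eq] at hq
    have : b + (k - b) = k := by omega
    simp only [this]
  · rintro ⟨⟨i, j⟩, k⟩ _
    simp

end FromQuarter

section FromPlanePartition

variable {α b : ℕ} {P : Finset (ℕ × ℕ × ℕ)}

lemma le_ppToQuarter_iff (hP : P ∈ symmetricTCPP (2 * α + 1) (2 * b)) {i j k : ℕ} (hi : 1 ≤ i)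
    (hij : i ≤ j) (hs : i + j ≤ 2 * α + 1) (hk : 1 ≤ k) (hkb : k ≤ b) :
    k ≤ ppToQuarter α b P i j ↔ (i, j, b + k) ∈ P := by
  have hpp := (mem_symmetricTCPP.1 hP).2.1
  rw [ppToQuarter, if_pos ⟨hi, hij, hs⟩]
  exact le_card_filter_Icc_iff (p := fun k => (i, j, b + k) ∈ P) (fun k k' hk' hkk _ hm =>
    hpp.down_closed i j (b + k) i j (b + k') hm hi le_rfl (hi.trans hij) le_rfl (by omega)
      (by omega)) hk hkb

lemma ppToQuarter_le (i j : ℕ) : ppToQuarter α b P i j ≤ b := by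
  unfold ppToQuarter
  split_ifs
  · refine (Finset.card_filter_le _ _).trans ?_
    simp
  · exact Nat.zero_le b

lemma isQuarter_ppToQuarter (hP : P ∈ symmetricTCPP (2 * α + 1) (2 * b)) :
    IsQuarter α b (ppToQuarter α b P) := by
  have hpp := (mem_symmetricTCPP.1 hP).2.1
  refine ⟨fun i j hij => if_neg (by omega), fun i j hi hij => ?_, fun i j hi hij => ?_,
    ppToQuarter_le 1 1⟩
  · by_cases hs : i + (j + 1) ≤ 2 * α + 1
    · rw [ppToQuarter, ppToQuarter, if_pos (by omega), if_pos (by omega)]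
      refine Finset.card_le_card fun k hk => ?_
      rw [Finset.mem_filter, Finset.mem_Icc] at hk ⊢
      exact ⟨hk.1, hpp.down_closed i (j + 1) (b + k) i j (b + k) hk.2 hi le_rfl (by omega)
        (by omega) (by omega) le_rfl⟩
    · rw [ppToQuarter, if_neg (by omega)]
      exact Nat.zero_le _
  · by_cases hs : i + 1 + j ≤ 2 * α + 1
    · rw [ppToQuarter, ppToQuarter, if_pos (by omega), if_pos (by omega)]
      refine Finset.card_le_card fun k hk => ?_
      rw [Finset.mem_filter, Finset.mem_Icc] at hk ⊢
      exact ⟨hk.1, hpp.down_closed (i + 1) j (b + k) i j (b + k) hk.2 hi (by omega) (by omega)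
        le_rfl (by omega) le_rfl⟩
    · rw [ppToQuarter, if_neg (by omega)]
      exact Nat.zero_le _

/-- The complement condition determines the columns beyond the antidiagonal from the quarter, and on
the antidiagonal it pairs the levels `k` and `2b + 1 - k` of one column. -/
lemma mem_iff_le_quarterHeight (hP : P ∈ symmetricTCPP (2 * α + 1) (2 * b)) {x y k : ℕ} (hx : 1 ≤ x)
    (hxy : x ≤ y) (hy : y ≤ 2 * α + 1) (hk : 1 ≤ k) (hkb : k ≤ 2 * b) :
    (x, y, k) ∈ P ↔ k ≤ quarterHeight α b (ppToQuarter α b P) x y := by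
  obtain ⟨-, hpp, -, htc⟩ := mem_symmetricTCPP.1 hP
  have hq := isQuarter_ppToQuarter hP
  -- If such a cube were missing, its complementary cube would be in `P`; that cube dominates it in
  -- all three coordinates, a contradiction.
  have low : ∀ x y k, 1 ≤ x → x ≤ y → x + y ≤ 2 * α + 2 → 1 ≤ k → k ≤ b → (x, y, k) ∈ P := by
    intro x y k hx hxy hs hk hkb
    by_contra hn
    have h1 := htc x y k hx (by omega) (by omega) (by omega) hk (by omega)
    have h2 : (2 * α + 1 + 1 - y, 2 * α + 1 + 1 - x, 2 * b + 1 - k) ∈ P := by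
      by_contra h3
      exact hn (h1.2 h3)
    exact hn (hpp.down_closed _ _ _ x y k h2 hx (by omega) (by omega) (by omega) hk (by omega))
  have below : ∀ x y k, 1 ≤ x → x ≤ y → x + y ≤ 2 * α + 1 → 1 ≤ k → k ≤ 2 * b →
      ((x, y, k) ∈ P ↔ k ≤ b + ppToQuarter α b P x y) := by
    intro x y k hx hxy hs hk hkb
    by_cases hkb' : k ≤ b
    · exact iff_of_true (low x y k hx hxy (by omega) hk hkb') (by omega)
    · have := le_ppToQuarter_iff hP hx hxy hs (k := k - b) (by omega) (by omega)
      rw [show b + (k - b) = k by omega] at this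
      rw [← this]
      omega
  unfold quarterHeight
  rcases lt_trichotomy (x + y) (2 * α + 2) with hlt | heq | hgt
  · rw [if_pos hlt.le]
    exact below x y k hx hxy (by omega) hk hkb
  · rw [if_pos heq.le, hq.zero x y (by omega)]
    by_cases hkb' : k ≤ b
    · exact iff_of_true (low x y k hx hxy (by omega) hk hkb') (by omega)
    · have h1 := htc x y k hx (by omega) (by omega) hy hk hkb
      rw [show 2 * α + 1 + 1 - y = x by omega, show 2 * α + 1 + 1 - x = y by omega] at h1
      have h2 := low x y (2 * b + 1 - k) hx hxy (by omega) (by omega) (by omega)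
      exact iff_of_false (fun h => h1.1 h h2) (by omega)
  · rw [if_neg (by omega), htc x y k hx (by omega) (by omega) hy hk hkb,
      below _ _ _ (by omega) (by omega) (by omega) (by omega) (by omega)]
    have := ppToQuarter_le (α := α) (b := b) (P := P) (2 * α + 2 - y) (2 * α + 2 - x)
    rw [show 2 * α + 1 + 1 - y = 2 * α + 2 - y by omega,
      show 2 * α + 1 + 1 - x = 2 * α + 2 - x by omega]
    omega

lemma quarterToPP_ppToQuarter (hP : P ∈ symmetricTCPP (2 * α + 1) (2 * b)) :
    quarterToPP α b (ppToQuarter α b P) = P := by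
  obtain ⟨hbox, hpp, hsym, htc⟩ := mem_symmetricTCPP.1 hP
  ext ⟨i, j, k⟩
  rw [mem_quarterToPP]
  have hmm : (i, j, k) ∈ P ↔ (min i j, max i j, k) ∈ P := by
    rcases le_total i j with h | h
    · rw [min_eq_left h, max_eq_right h]
    · rw [min_eq_right h, max_eq_left h]
      exact ⟨hsym i j k, hsym j i k⟩
  constructor
  · rintro ⟨hb, hk⟩
    rw [hmm, mem_iff_le_quarterHeight hP (by omega) (by omega) (by omega) hb.2.2.1 hb.2.2.2]
    exact hk
  · intro h
    have hb := mem_planePartitionBox.1 (hbox h)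
    refine ⟨hb, ?_⟩
    rwa [hmm, mem_iff_le_quarterHeight hP (by omega) (by omega) (by omega) hb.2.2.1 hb.2.2.2] at h

end FromPlanePartition

/-- Partitions, quarters and arrays correspond with equal signs. Heights up to `b`, shifted by
positions up to `α - 1`, give top-row entries below `b + α`. -/
theorem signedSymmetricTCPP_eq_pointDetSum {α : ℕ} (hα : 1 ≤ α) (b : ℕ) :
    (signedSymmetricTCPP (2 * α + 1) b : ℚ) = pointDetSum α (b + α) := by
  classical
  have htop : ∀ {l : Fin α → ℕ} {a : ℕ → ℕ → ℕ}, IsArray α a → (∀ j : Fin α, a (2 * α) j = l j) →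
      StrictMono l := by
    intro l a ha hl
    obtain ⟨β, rfl⟩ : ∃ β, α = β + 1 := ⟨α - 1, by omega⟩
    refine Fin.strictMono_iff_lt_succ.2 fun i => ?_
    rw [← hl, ← hl]
    have h1 := ha.even_lt β (by omega) i (by omega)
    have h2 := ha.le_even β (by omega) (i + 1) (by omega)
    exact lt_of_lt_of_le h1 h2
  have hmem : ∀ a : ℕ → ℕ → ℕ, a ∈ (increasing α (b + α)).biUnion (arraysWithTop α) ↔
      IsArray α a ∧ ∀ j < α, a (2 * α) j < b + α := by
    intro a
    rw [Finset.mem_biUnion]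
    constructor
    · rintro ⟨l, hl, ha⟩
      obtain ⟨h1, h2⟩ := mem_arraysWithTop.1 ha
      refine ⟨h1, fun j hj => ?_⟩
      rw [h2 ⟨j, hj⟩]
      exact (mem_increasing.1 hl).1 _
    · rintro ⟨h1, h2⟩
      exact ⟨fun j => a (2 * α) j, mem_increasing.2 ⟨fun j => h2 j j.2, htop h1 fun _ => rfl⟩,
        mem_arraysWithTop.2 ⟨h1, fun _ => rfl⟩⟩
  have hsum : pointDetSum α (b + α) = ∑ a ∈ (increasing α (b + α)).biUnion (arraysWithTop α),
      (-1 : ℚ) ^ arrayWeight α a := by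
    rw [Finset.sum_biUnion]
    · exact Finset.sum_congr rfl fun l hl => (sum_arraysWithTop l (mem_increasing.1 hl).2).symm
    · intro l _ l' _ hne
      refine Finset.disjoint_left.2 fun a ha ha' => hne ?_
      funext j
      rw [← (mem_arraysWithTop.1 ha).2 j, ← (mem_arraysWithTop.1 ha').2 j]
  rw [hsum, signedSymmetricTCPP]
  push_cast
  refine Finset.sum_nbij' (fun P => quarterToArray α (ppToQuarter α b P))
    (fun a => quarterToPP α b (arrayToQuarter α a)) ?_ ?_ ?_ ?_ ?_
  · intro P hP
    have hq := isQuarter_ppToQuarter hP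
    exact (hmem _).2 ⟨hq.isArray, hq.top_lt⟩
  · intro a ha
    obtain ⟨h1, h2⟩ := (hmem a).1 ha
    exact (h1.isQuarter hα h2).quarterToPP_mem
  · intro P hP
    rw [arrayToQuarter_quarterToArray (isQuarter_ppToQuarter hP), quarterToPP_ppToQuarter hP]
  · intro a ha
    obtain ⟨h1, h2⟩ := (hmem a).1 ha
    rw [(h1.isQuarter hα h2).ppToQuarter_quarterToPP, quarterToArray_arrayToQuarter h1]
  · intro P hP
    have hq := isQuarter_ppToQuarter hP
    rw [neg_one_pow_arrayWeight, ← hq.upperRightCount_quarterToPP, quarterToPP_ppToQuarter hP]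

end PlanePartitions

/-! ### Splitting off the known roots -/

section Factorization

/-- The polynomial of the parity class has degree exactly `α(α + 1)/2`, so dividing out the
prescribed roots leaves a cofactor of known degree. -/
lemma exists_cofactor {α : ℕ} (hα : 1 ≤ α) (ε : ℤ) (s : Multiset ℤ)
    (hs : ∀ P : ℚ[X], (∀ N : ℕ, Even ((N : ℤ) - ε) → pointDetSum α N = P.eval (N : ℚ)) →
      ∀ a ∈ s, (X - C (a : ℚ)) ^ s.count a ∣ P) :
    ∃ Q : ℚ[X], Q ≠ 0 ∧ 2 * (Q.natDegree + s.card) = α * (α + 1) ∧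
      ∀ b : ℕ, Even ((b : ℤ) + α - ε) → (signedSymmetricTCPP (2 * α + 1) b : ℚ) =
        (s.map fun a : ℤ => (b : ℚ) + α - a).prod * Q.eval ((b : ℚ) + α) := by
  classical
  obtain ⟨c, hc, hlead⟩ := exists_hasLeading_pointDetSum α hα
  obtain ⟨P, h1, h2, h3⟩ := hlead ε.natAbs
  have hP : ∀ N : ℕ, Even ((N : ℤ) - ε) → pointDetSum α N = P.eval (N : ℚ) := by
    rintro N ⟨r, hr⟩
    exact h3 N (by omega)
  have hP0 : P ≠ 0 := by
    rintro rfl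
    exact hc (by simpa using h2.symm)
  have hPd : P.natDegree = ∑ j : Fin α, ((j : ℕ) + 1) :=
    natDegree_eq_of_le_of_coeff_ne_zero h1 (by rw [h2]; exact hc)
  have hinj : Function.Injective (Int.cast : ℤ → ℚ) := Int.cast_injective
  have hle : s.map (Int.cast : ℤ → ℚ) ≤ P.roots := by
    refine Multiset.le_iff_count.2 fun x => ?_
    by_cases hx : x ∈ s.map (Int.cast : ℤ → ℚ)
    · obtain ⟨a, ha, rfl⟩ := Multiset.mem_map.1 hx
      rw [Multiset.count_map_eq_count' _ _ hinj, count_roots]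
      exact (le_rootMultiplicity_iff hP0).2 (hs P hP a ha)
    · rw [Multiset.count_eq_zero_of_notMem hx]
      exact Nat.zero_le _
  obtain ⟨Q, hQ⟩ := (Multiset.prod_X_sub_C_dvd_iff_le_roots hP0 _).2 hle
  have hQ0 : Q ≠ 0 := by
    rintro rfl
    exact hP0 (by rw [hQ, mul_zero])
  refine ⟨Q, hQ0, ?_, fun b hb => ?_⟩
  · have hm : (((s.map (Int.cast : ℤ → ℚ)).map fun a => X - C a).prod).Monic :=
      monic_multiset_prod_of_monic _ _ fun a _ => monic_X_sub_C a
    have hd := congrArg natDegree hQ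
    rw [hm.natDegree_mul' hQ0, natDegree_multiset_prod_X_sub_C_eq_card, Multiset.card_map,
      hPd] at hd
    rw [add_comm, ← hd, Fin.sum_univ_eq_sum_range (fun j => j + 1), Finset.sum_add_distrib,
      mul_add, mul_comm 2, Finset.sum_range_id_mul_two]
    obtain ⟨β, rfl⟩ : ∃ β, α = β + 1 := ⟨α - 1, by omega⟩
    simp only [Finset.sum_const, Finset.card_range, smul_eq_mul, Nat.add_sub_cancel]
    ring
  · have e : ((b + α : ℕ) : ℚ) = b + α := by push_cast; rfl
    rw [signedSymmetricTCPP_eq_pointDetSum hα, hP (b + α) (by push_cast; exact hb), hQ, e, eval_mul,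
      eval_multiset_prod, Multiset.map_map, Multiset.map_map]
    congr 2
    refine Multiset.map_congr rfl fun a _ => ?_
    simp

/-- The factorization with half-integral linear factors indexed by a finset, and with further
roots `t`. -/
lemma exists_cofactor_of_finset {α : ℕ} (hα : 1 ≤ α) (ε : ℤ) {ι : Type*} (I : Finset ι)
    (ρ : ι → ℤ) (t : Multiset ℤ) (hpar : ∀ i ∈ I, Even (ρ i - ε)) (ht : t.Nodup)
    (htI : ∀ i ∈ I, ρ i ∉ t)
    (htP : ∀ P : ℚ[X], (∀ N : ℕ, Even ((N : ℤ) - ε) → pointDetSum α N = P.eval (N : ℚ)) →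
      ∀ a ∈ t, P.eval (a : ℚ) = 0)
    (hcount : ∀ i ∈ I, 2 * (I.filter fun j => ρ j = ρ i).card + foldIndex (ρ i) ≤ α + 1)
    {d : ℕ} (hd : 2 * (d + (I.card + t.card)) = α * (α + 1)) :
    ∃ p : ℚ[X], p.degree = (d : WithBot ℕ) ∧
      ∀ b : ℕ, Even ((b : ℤ) + α - ε) → (signedSymmetricTCPP (2 * α + 1) b : ℚ) =
        (∏ i ∈ I, ((b : ℚ) + α - ρ i) / 2) * (t.map fun a : ℤ => (b : ℚ) + α - a).prod *
          p.eval (b : ℚ) := by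
  classical
  obtain ⟨Q, hQ0, hQd, hQ⟩ := exists_cofactor hα ε (I.val.map ρ + t) (by
    intro P hP a ha
    rw [Multiset.count_add]
    by_cases hat : a ∈ t
    · have h0 : (I.val.map ρ).count a = 0 := by
        refine Multiset.count_eq_zero_of_notMem fun h => ?_
        obtain ⟨i, hi, rfl⟩ := Multiset.mem_map.1 h
        exact htI i hi hat
      rw [h0, zero_add, Multiset.count_eq_one_of_mem ht hat, pow_one]
      exact dvd_iff_isRoot.2 (htP P hP a hat)
    · have ha' : a ∈ I.val.map ρ := (Multiset.mem_add.1 ha).resolve_right hat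
      obtain ⟨i, hi, rfl⟩ := Multiset.mem_map.1 ha'
      rw [Multiset.count_eq_zero_of_notMem hat, add_zero]
      refine X_sub_C_pow_dvd_of_eq_pointDetSum (α := α) (fun N hN => hP N ?_) ?_
      · have := hN.add (hpar i hi)
        rwa [sub_add_sub_cancel] at this
      · rw [Multiset.count_map]
        have e : (I.val.filter fun j => ρ i = ρ j) = (I.filter fun j => ρ j = ρ i).val := by
          rw [Finset.filter_val]
          exact Multiset.filter_congr fun _ _ => eq_comm
        rw [e]
        exact hcount i hi)
  rw [Multiset.card_add, Multiset.card_map, ← Finset.card_def] at hQd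
  have h2 : (2 : ℚ) ^ I.card ≠ 0 := by positivity
  -- The power of two compensates for the halved linear factors, and the shift passes from the
  -- number of points `b + α` to `b`.
  refine ⟨C ((2 : ℚ) ^ I.card) * Q.comp (X + C (α : ℚ)), ?_, fun b hb => ?_⟩
  · have hne : Q.comp (X + C (α : ℚ)) ≠ 0 := by
      intro h
      rcases comp_eq_zero_iff.1 h with h | h
      · exact hQ0 h
      · have := congrArg natDegree h.2
        rw [natDegree_X_add_C, natDegree_C] at this
        exact one_ne_zero this
    rw [degree_C_mul h2, degree_eq_natDegree hne, natDegree_comp, natDegree_X_add_C, mul_one]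
    congr 1
    omega
  · rw [hQ b hb, Multiset.map_add, Multiset.prod_add, Multiset.map_map, eval_mul, eval_C, eval_comp,
      eval_add, eval_X, eval_C, Finset.prod_div_distrib, Finset.prod_const]
    have e : (I.val.map ((fun a : ℤ => (b : ℚ) + α - a) ∘ ρ)).prod =
        ∏ i ∈ I, ((b : ℚ) + α - ρ i) := rfl
    rw [e]
    field_simp

end Factorization

/-! ### Counting repeated factors -/

section RootCounts

lemma foldIndex_of_nonneg {z : ℤ} (h : 0 ≤ z) : foldIndex z = z.toNat := if_pos h

lemma foldIndex_of_neg {z : ℤ} (h : z < 0) : foldIndex z = (-1 - z).toNat := if_neg (not_le.2 h)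

/-- Bounds how often the factor with `k + t = c` occurs in the product for even `α`: a pair is
determined by `k`, which lies in an interval. -/
lemma card_filter_add_eq_le (h : ℕ) (c : ℕ) :
    (((Finset.Icc 1 h) ×ˢ (Finset.range (h + 1))).filter fun q => q.1 + q.2 = c).card ≤
      min c (2 * h + 1 - c) := by
  have : (((Finset.Icc 1 h) ×ˢ (Finset.range (h + 1))).filter fun q => q.1 + q.2 = c).card ≤
      (Finset.Icc (max 1 (c - h)) (min h c)).card := by
    refine Finset.card_le_card_of_injOn Prod.fst ?_ ?_
    · rintro ⟨k, t⟩ hq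
      simp only [Finset.coe_filter, Set.mem_ofPred_eq, Finset.mem_product, Finset.mem_Icc,
        Finset.mem_range] at hq
      simp only [Finset.coe_Icc, Set.mem_Icc]
      omega
    · rintro ⟨k, t⟩ hq ⟨k', t'⟩ hq' hk
      simp only [Finset.coe_filter, Set.mem_ofPred_eq] at hq hq' hk
      ext <;> dsimp only <;> omega
  rw [Nat.card_Icc] at this
  omega

/-- The counterpart for odd `α`: the index `i` determines the pair and must exceed `|j|`. -/
lemma card_filter_sub_eq_le (h : ℕ) (j : ℤ) :
    (((Finset.Icc 1 h).sigma fun i => Finset.range (2 * i - 1)).filter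
      fun q => (q.1 : ℤ) - 1 - (q.2 : ℤ) = j).card ≤ h - j.natAbs := by
  have : (((Finset.Icc 1 h).sigma fun i => Finset.range (2 * i - 1)).filter
      fun q => (q.1 : ℤ) - 1 - (q.2 : ℤ) = j).card ≤ (Finset.Icc (j.natAbs + 1) h).card := by
    refine Finset.card_le_card_of_injOn Sigma.fst ?_ ?_
    · rintro ⟨k, t⟩ hq
      simp only [Finset.coe_filter, Set.mem_ofPred_eq, Finset.mem_sigma, Finset.mem_Icc,
        Finset.mem_range] at hq
      simp only [Finset.coe_Icc, Set.mem_Icc]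
      omega
    · rintro ⟨k, t⟩ hq ⟨k', t'⟩ hq' hk
      simp only [Finset.coe_filter, Set.mem_ofPred_eq] at hq hq' hk
      subst hk
      have : t = t' := by omega
      rw [this]
  rw [Nat.card_Icc] at this
  omega

lemma sum_Icc_two_mul_sub_one (h : ℕ) : ∑ i ∈ Finset.Icc 1 h, (2 * i - 1) = h ^ 2 := by
  induction h with
  | zero => simp
  | succ h ih =>
    rw [Finset.sum_Icc_succ_top (by omega), ih]
    have : 2 * (h + 1) - 1 = 2 * h + 1 := by omega
    rw [this]
    ring

end RootCounts

/-! ### The four factorizations -/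

section Main

/-- With `N = b + 2h` points and `c = k + t`, a factor of the shifted factorials is half of `N - (2h
+ δ - 2c)`. Its multiplicity `min c (2h + 1 - c)` is within the bound from nilpotency, and `e` is
the extra root. The remaining degree is `h(2h + 1) - h(h + 1) - 1`. -/
lemma exists_factorization_even (h : ℕ) (hh : 1 ≤ h) (δ : ℤ) (e : ℤ)
    (hδ : δ = 0 ∧ e = -2 * h - 2 ∨ δ = 1 ∧ e = 2 * h + 1) :
    ∃ p : ℚ[X], p.degree = ((h ^ 2 - 1 : ℕ) : WithBot ℕ) ∧
      ∀ b : ℕ, Even ((b : ℤ) - δ) → (signedSymmetricTCPP (2 * (2 * h) + 1) b : ℚ) =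
        (∏ k ∈ Finset.Icc 1 h, shiftedFactorial (((b : ℚ) - δ) / 2 + (k : ℚ)) (h + 1)) *
          ((b : ℚ) + 2 * h - e) * p.eval (b : ℚ) := by
  obtain ⟨p, hp, hp'⟩ := exists_cofactor_of_finset (α := 2 * h) (by omega) δ
    ((Finset.Icc 1 h) ×ˢ (Finset.range (h + 1))) (fun q => 2 * h + δ - 2 * ((q.1 + q.2 : ℕ) : ℤ)) {e}
    (fun q _ => ⟨h - ((q.1 + q.2 : ℕ) : ℤ), by ring⟩) (Multiset.nodup_singleton e)
    (by
      rintro ⟨k, t⟩ hq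
      simp only [Finset.mem_product, Finset.mem_Icc, Finset.mem_range] at hq
      rw [Multiset.mem_singleton]
      dsimp only
      push_cast
      omega)
    (by
      intro P hP a ha
      rw [Multiset.mem_singleton] at ha
      subst ha
      rcases hδ with ⟨rfl, rfl⟩ | ⟨rfl, rfl⟩
      -- For even `b` the extra root is the reflection `-1 - (2h + 1)` of the vanishing point; for
      -- odd `b` it is `2h + 1` itself.
      · have := eval_neg_one_sub_of_eq_pointDetSum (m := h) (P := P) (2 * h + 1) (fun N hN => hP N (by
          obtain ⟨r, hr⟩ := hN
          exact ⟨r - h - 1, by push_cast at hr; omega⟩))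
        rw [pointDetSum_two_mul_succ h hh, mul_zero] at this
        rw [← this]
        congr 1
        push_cast
        ring
      · have := hP (2 * h + 1) ⟨h, by push_cast; ring⟩
        rw [pointDetSum_two_mul_succ h hh] at this
        rw [this]
        congr 1)
    (by
      rintro ⟨k, t⟩ hq
      simp only [Finset.mem_product, Finset.mem_Icc, Finset.mem_range] at hq
      have hc := card_filter_add_eq_le h (k + t)
      have hf : ((Finset.Icc 1 h) ×ˢ (Finset.range (h + 1))).filter (fun q : ℕ × ℕ =>
          2 * (h : ℤ) + δ - 2 * ((q.1 + q.2 : ℕ) : ℤ) = 2 * h + δ - 2 * ((k + t : ℕ) : ℤ)) =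
          ((Finset.Icc 1 h) ×ˢ (Finset.range (h + 1))).filter fun q => q.1 + q.2 = k + t := by
        refine Finset.filter_congr fun q _ => ?_
        omega
      dsimp only
      rw [hf]
      rcases le_or_gt 0 (2 * (h : ℤ) + δ - 2 * ((k + t : ℕ) : ℤ)) with h0 | h0
      · rw [foldIndex_of_nonneg h0]
        omega
      · rw [foldIndex_of_neg h0]
        omega)
    (d := h ^ 2 - 1)
    (by
      rw [Finset.card_product, Nat.card_Icc, Finset.card_range, Multiset.card_singleton]
      have : 1 ≤ h ^ 2 := Nat.one_le_pow _ _ hh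
      zify [this]
      simp only [Nat.add_sub_cancel]
      ring)
  refine ⟨p, hp, fun b hb => ?_⟩
  rw [hp' b (by
    obtain ⟨r, hr⟩ := hb
    exact ⟨r + h, by push_cast; omega⟩), Finset.prod_product]
  simp only [Multiset.map_singleton, Multiset.prod_singleton, shiftedFactorial]
  push_cast
  congr 2
  refine Finset.prod_congr rfl fun k _ => Finset.prod_congr rfl fun t _ => ?_
  ring

/-- Here `N = b + 2h - 1`, and the factors are halves of `N - (2j + δ - 1)` with `j = i - 1 - t`,
each occurring at most `h - |j|` times. The `h ^ 2` factors leave degree `h(2h - 1) - h ^ 2`. -/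
lemma exists_factorization_odd (h : ℕ) (hh : 1 ≤ h) (δ : ℤ) (hδ : δ = 0 ∨ δ = 1) :
    ∃ p : ℚ[X], p.degree = ((h ^ 2 - h : ℕ) : WithBot ℕ) ∧
      ∀ b : ℕ, Even ((b : ℤ) - δ) → (signedSymmetricTCPP (2 * (2 * h - 1) + 1) b : ℚ) =
        (∏ i ∈ Finset.Icc 1 h,
          shiftedFactorial (((b : ℚ) + (2 * h - 1) + 1 - δ) / 2 - i + 1) (2 * i - 1)) *
          p.eval (b : ℚ) := by
  obtain ⟨p, hp, hp'⟩ := exists_cofactor_of_finset (α := 2 * h - 1) (by omega) (δ - 1)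
    ((Finset.Icc 1 h).sigma fun i => Finset.range (2 * i - 1))
    (fun q => 2 * ((q.1 : ℤ) - 1 - (q.2 : ℤ)) + (δ - 1)) 0
    (fun q _ => ⟨(q.1 : ℤ) - 1 - (q.2 : ℤ), by ring⟩) Multiset.nodup_zero (by simp) (by simp)
    (by
      rintro ⟨i, t⟩ hq
      simp only [Finset.mem_sigma, Finset.mem_Icc, Finset.mem_range] at hq
      have hc := card_filter_sub_eq_le h ((i : ℤ) - 1 - (t : ℤ))
      have hf : ((Finset.Icc 1 h).sigma fun i => Finset.range (2 * i - 1)).filter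
          (fun q : (_ : ℕ) × ℕ => 2 * ((q.1 : ℤ) - 1 - (q.2 : ℤ)) + (δ - 1) =
            2 * ((i : ℤ) - 1 - (t : ℤ)) + (δ - 1)) =
          ((Finset.Icc 1 h).sigma fun i => Finset.range (2 * i - 1)).filter
            fun q => (q.1 : ℤ) - 1 - (q.2 : ℤ) = (i : ℤ) - 1 - (t : ℤ) := by
        refine Finset.filter_congr fun q _ => ?_
        omega
      dsimp only
      rw [hf]
      rcases le_or_gt 0 (2 * ((i : ℤ) - 1 - (t : ℤ)) + (δ - 1)) with h0 | h0
      · rw [foldIndex_of_nonneg h0]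
        omega
      · rw [foldIndex_of_neg h0]
        omega)
    (d := h ^ 2 - h)
    (by
      rw [Finset.card_sigma, Multiset.card_zero]
      simp only [Finset.card_range]
      rw [sum_Icc_two_mul_sub_one, Nat.sub_add_cancel (by omega)]
      have h1 : h ≤ h ^ 2 := Nat.le_self_pow two_ne_zero h
      zify [h1, show 1 ≤ 2 * h by omega]
      ring)
  refine ⟨p, hp, fun b hb => ?_⟩
  rw [hp' b (by
    obtain ⟨r, hr⟩ := hb
    exact ⟨r + h, by omega⟩), Finset.prod_sigma]
  simp only [Multiset.map_zero, Multiset.prod_zero, mul_one, shiftedFactorial]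
  rw [Nat.cast_sub (by omega)]
  push_cast
  congr 1
  refine Finset.prod_congr rfl fun k _ => Finset.prod_congr rfl fun t _ => ?_
  ring

theorem theorem3 (α : ℕ) (hα : 1 ≤ α) :
    (Even α → ∃ p₁ : ℚ[X], p₁.degree = (((α / 2) ^ 2 - 1 : ℕ) : WithBot ℕ) ∧
      ∀ b : ℕ, Even b → (signedSymmetricTCPP (2 * α + 1) b : ℚ) =
        (∏ k ∈ Finset.Icc 1 (α / 2), shiftedFactorial ((b : ℚ) / 2 + (k : ℚ)) (α / 2 + 1)) *
          ((b : ℚ) + 2 * (α : ℚ) + 2) * p₁.eval (b : ℚ)) ∧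
    (Even α → ∃ p₂ : ℚ[X], p₂.degree = (((α / 2) ^ 2 - 1 : ℕ) : WithBot ℕ) ∧
      ∀ b : ℕ, Odd b → (signedSymmetricTCPP (2 * α + 1) b : ℚ) =
        (∏ k ∈ Finset.Icc 1 (α / 2),
            shiftedFactorial (((b : ℚ) - 1) / 2 + (k : ℚ)) (α / 2 + 1)) *
          ((b : ℚ) - 1) * p₂.eval (b : ℚ)) ∧
    (Odd α → ∃ p₃ : ℚ[X], p₃.degree = (((α ^ 2 - 1) / 4 : ℕ) : WithBot ℕ) ∧
      ∀ b : ℕ, Even b → (signedSymmetricTCPP (2 * α + 1) b : ℚ) =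
        (∏ i ∈ Finset.Icc 1 ((α + 1) / 2),
            shiftedFactorial (((α : ℚ) + (b : ℚ) - 1) / 2 - (i : ℚ) + 2) (2 * i - 1)) *
          p₃.eval (b : ℚ)) ∧
    (Odd α → ∃ p₄ : ℚ[X], p₄.degree = (((α ^ 2 - 1) / 4 : ℕ) : WithBot ℕ) ∧
      ∀ b : ℕ, Odd b → (signedSymmetricTCPP (2 * α + 1) b : ℚ) =
        (∏ i ∈ Finset.Icc 1 ((α + 1) / 2),
            shiftedFactorial (((b : ℚ) + (α : ℚ)) / 2 - (i : ℚ) + 1) (2 * i - 1)) *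
          p₄.eval (b : ℚ)) := by
  have hev : ∀ b : ℕ, Even b → Even ((b : ℤ) - (0 : ℤ)) := fun b hb => by simpa using hb
  have hod : ∀ b : ℕ, Odd b → Even ((b : ℤ) - (1 : ℤ)) := fun b hb => by
    obtain ⟨r, hr⟩ := hb
    exact ⟨r, by omega⟩
  have heven : ∀ h, α = 2 * h → 1 ≤ h ∧ α / 2 = h := fun h hh => by omega
  -- For `α = 2h + 1` the odd factorization is used with parameter `h + 1`.
  have hodd : ∀ h, α = 2 * h + 1 → α = 2 * (h + 1) - 1 ∧ (α + 1) / 2 = h + 1 ∧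
      (α ^ 2 - 1) / 4 = (h + 1) ^ 2 - (h + 1) ∧ (α : ℚ) = 2 * ((h + 1 : ℕ) : ℚ) - 1 := by
    rintro h rfl
    refine ⟨by omega, by omega, ?_, by push_cast; ring⟩
    have e1 : (2 * h + 1) ^ 2 - 1 = 4 * (h * (h + 1)) := by
      rw [show (2 * h + 1) ^ 2 = 4 * (h * (h + 1)) + 1 by ring, Nat.add_sub_cancel]
    have e2 : (h + 1) ^ 2 - (h + 1) = h * (h + 1) := by
      rw [show (h + 1) ^ 2 = h * (h + 1) + (h + 1) by ring, Nat.add_sub_cancel]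
    rw [e1, e2, Nat.mul_div_cancel_left _ (by norm_num)]
  refine ⟨fun hα2 => ?_, fun hα2 => ?_, fun hα2 => ?_, fun hα2 => ?_⟩
  · obtain ⟨h, hh⟩ := even_iff_exists_two_mul.1 hα2
    obtain ⟨h1, h2⟩ := heven h hh
    obtain ⟨p, hp, hp'⟩ := exists_factorization_even h h1 0 (-2 * h - 2) (Or.inl ⟨rfl, rfl⟩)
    refine ⟨p, by rw [h2, hp], fun b hb => ?_⟩
    rw [h2, hh, hp' b (hev b hb)]
    push_cast
    rw [sub_zero]
    ring
  · obtain ⟨h, hh⟩ := even_iff_exists_two_mul.1 hα2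
    obtain ⟨h1, h2⟩ := heven h hh
    obtain ⟨p, hp, hp'⟩ := exists_factorization_even h h1 1 (2 * h + 1) (Or.inr ⟨rfl, rfl⟩)
    refine ⟨p, by rw [h2, hp], fun b hb => ?_⟩
    rw [h2, hh, hp' b (hod b hb)]
    push_cast
    ring
  · obtain ⟨h, hh⟩ := hα2
    obtain ⟨h1, h2, h3, h4⟩ := hodd h hh
    obtain ⟨p, hp, hp'⟩ := exists_factorization_odd (h + 1) (by omega) 0 (Or.inl rfl)
    refine ⟨p, by rw [h3, hp], fun b hb => ?_⟩
    rw [h2, h4]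
    refine Eq.trans (by rw [h1]) ((hp' b (hev b hb)).trans ?_)
    congr 1
    refine Finset.prod_congr rfl fun i _ => ?_
    congr 1
    push_cast
    ring
  · obtain ⟨h, hh⟩ := hα2
    obtain ⟨h1, h2, h3, h4⟩ := hodd h hh
    obtain ⟨p, hp, hp'⟩ := exists_factorization_odd (h + 1) (by omega) 1 (Or.inr rfl)
    refine ⟨p, by rw [h3, hp], fun b hb => ?_⟩
    rw [h2, h4]
    refine Eq.trans (by rw [h1]) ((hp' b (hod b hb)).trans ?_)
    congr 1
    refine Finset.prod_congr rfl fun i _ => ?_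
    congr 1
    push_cast
    ring

end Main
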